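/- **Setting.** Let $\mathcal M=(\mathcal X,\mathcal A,r,P,\gamma,\nu_0)$ be a discounted MDP with finite state space $\mathcal X$, finite action space $\mathcal A$ with $|\mathcal A|\ge 2$, reward $r:\mathcal X\times\mathcal A\to[0,1]$, transition probabilities $P(\cdot\mid x,a)$, discount factor $\gamma\in(0,1)$ and initial state distribution $\nu_0$. Put $H=\frac1{1-\gamma}$. For a stationary policy $\pi$ let $\nu^\pi(x)=(1-\gamma)\sum_{t\ge0}\gamma^t\,\mathbb P_\pi[X_t=x]$ (with $X_0\sim\nu_0$), $\mu^\pi(x,a)=\nu^\pi(x)\pi(a\mid x)$, and $\langle\mu^\pi,r\rangle=\sum_{x,a}\mu^\pi(x,a)r(x,a)$. Let $\pi^*$ be a policy whose occupancy measure $\mu^*=\mu^{\pi^*}$ maximizes $\langle\mu^\pi,r\rangle$ over stationary policies, let $\nu^*=\nu^{\pi^*}$, and for a policy $\pi_0$ put $\mathcal H(\pi^*\|\pi_0)=\sum_x\nu^*(x)\sum_a\pi^*(a\mid x)\log\frac{\pi^*(a\mid x)}{\pi_0(a\mid x)}$. **Algorithm (RAVI-UCB).** Given $T\ge1$, $\eta>0$,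 $V_0:\mathcal X\to\mathbb R$ and a policy $\pi_0$, set $Q_1(x,a)=V_0(x)$. The algorithm proceeds in epochs $k=1,2,\dots$; the first round of epoch $k$ is $T_k$, with $T_1=1$. At the start of epoch $k$, a real-valued kernel $\widehat P_k(x'\mid x,a)$ and a bonus $\mathrm{CB}_k:\mathcal X\times\mathcal A\to\mathbb R$ are computed as arbitrary (fixed) functions of the data gathered in the rounds before $T_k$, and $$V_k(x)=\tfrac1\eta\log\sum_a\pi_{k-1}(a\mid x)e^{\eta Q_k(x,a)},\qquad \pi_k(a\mid x)=\pi_{k-1}(a\mid x)e^{\eta(Q_k(x,a)-V_k(x))},$$ $$Q_{k+1}(x,a)=\max\Big\{\min\Big\{r(x,a)+\mathrm{CB}_k(x,a)+\gamma\sum_{x'}\widehat P_k(x'\mid x,a)V_k(x'),\,H\Big\},0\Big\}.$$ The first state is drawn from $\nu_0$. In each round $t$ of epoch $k$ the action $A_t\sim\pi_k(\cdot\mid X_t)$ is played and the next state, drawn from $P(\cdot\mid X_t,A_t)$, is observed; then, independently with probability $1-\gamma$, the state is reset (i.e. $X_{t+1}$ is drawn afresh from $\nu_0$) and epoch $k+1$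 starts with round $t+1$; otherwise $X_{t+1}$ is the observed state and epoch $k$ continues. The data of a round consist of its state, its action, the observed next state, and whether a reset took place. For a round $t$ of epoch $k$ write $\pi_t=\pi_k$, $\mathrm{CB}_t=\mathrm{CB}_k$. The trajectory is continued beyond round $T$, and $T^+$ is the first round $t\ge T$ at the end of which a reset occurs. The expected regret is $\mathfrak R_T=\mathbb E\big[\sum_{t=1}^T\langle\mu^*-\mu^{\pi_t},r\rangle\big]$. **Theorem.** Run RAVI-UCB with $V_0=0$, $\eta=\sqrt{2\log|\mathcal A|/(H^2T)}$ and a policy $\pi_0$. Suppose that the bonuses are valid: almost surely, for every epoch $k$ that starts at or before round $T$ and for all $x,a$, $$\Big|\sum_{x'}\big(\gamma P(x'\mid x,a)-\gamma\widehat P_k(x'\mid x,a)\big)V_k(x')\Big|\le\mathrm{CB}_k(x,a).$$ Then $\sum_{t=1}^T\langle\mu^*-\mu^{\pi_t},r\rangle$ and $\sum_{t=1}^{T^+}\mathrm{CB}_t(X_t,A_t)$ are integrable, and: 1. if $\pi_0(a\mid x)>0$ whenever $\mu^*(x,a)>0$, then $$\mathfrak R_T\le 2\,\mathbb E\Big[\sum_{t=1}^{T^+}\mathrm{CB}_t(X_t,A_t)\Big]+\sqrt{\frac{H^4T}{2\log|\mathcal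 A|}}\,\big(\mathcal H(\pi^*\|\pi_0)+\log|\mathcal A|\big)+2H^2;$$ 2. if $\pi_0$ is the uniform policy, then $$\mathfrak R_T\le 2\,\mathbb E\Big[\sum_{t=1}^{T^+}\mathrm{CB}_t(X_t,A_t)\Big]+\sqrt{2H^4\log|\mathcal A|\,T}+2H^2.$$ -/

import Mathlib

open MeasureTheory ProbabilityTheory

namespace RaviUCB

/-- A finite discounted Markov decision process. Probability distributions on a finite set are
points of the standard simplex. -/
structure MDP (X A : Type*) [Fintype X] [Fintype A] where
  /-- the reward function -/
  r : X → A → ℝ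
  r_nonneg : ∀ x a, 0 ≤ r x a
  r_le_one : ∀ x a, r x a ≤ 1
  /-- the transition function: `P x a x'` is the probability of moving to `x'` -/
  P : X → A → stdSimplex ℝ X
  /-- the discount factor -/
  γ : ℝ
  γ_pos : 0 < γ
  γ_lt_one : γ < 1
  /-- the initial state distribution -/
  ν₀ : stdSimplex ℝ X

/-- A stationary policy. -/
abbrev Policy (X A : Type*) [Fintype A] := X → stdSimplex ℝ A

noncomputable section

/-- A point of the simplex, seen as a probability mass function. -/
def toPMF {ι : Type*} [Fintype ι] (p : stdSimplex ℝ ι) : PMF ι :=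
  PMF.ofFintype (fun i => ENNReal.ofReal (p i)) (by
    have h : ∑ i, ENNReal.ofReal (p i) = ENNReal.ofReal (∑ i, p i) :=
      (ENNReal.ofReal_sum_of_nonneg fun i _ => p.2.1 i).symm
    have h1 : ∑ i, p i = 1 := p.2.2
    rw [h, h1, ENNReal.ofReal_one])

namespace MDP

variable {X A : Type*} [Fintype X] [Fintype A] (M : MDP X A)

/-- The effective horizon `H = 1 / (1 - γ)`. -/
def H : ℝ := 1 / (1 - M.γ)

/-- The probability that `X_t = x` when the states start from `ν₀` and the policy `π` is followed
at all times. -/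
def stateProb (π : Policy X A) : ℕ → X → ℝ
  | 0 => fun x => M.ν₀ x
  | t + 1 => fun x' => ∑ x, ∑ a, stateProb π t x * π x a * M.P x a x'

/-- The normalized discounted state occupancy measure of a policy. -/
def stateOcc (π : Policy X A) (x : X) : ℝ := (1 - M.γ) * ∑' t : ℕ, M.γ ^ t * M.stateProb π t x

/-- The normalized discounted state-action occupancy measure of a policy. -/
def occ (π : Policy X A) (x : X) (a : A) : ℝ := M.stateOcc π x * π x a

/-- The normalized return `⟨μ^π, r⟩` of a policy. -/
def ret (π : Policy X A) : ℝ := ∑ x, ∑ a, M.occ π x a * M.r x a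

/-- The occupancy measure of `π` has maximal return. -/
def IsOptimal (π : Policy X A) : Prop := ∀ π' : Policy X A, M.ret π' ≤ M.ret π

/-- The conditional relative entropy `⟨ν^π, KL(π ‖ π')⟩`, for `π'` that charges every action
charged by `π` in the states charged by `ν^π`. -/
def condRelEntropy (π π' : Policy X A) : ℝ :=
  ∑ x, M.stateOcc π x * ∑ a, π x a * Real.log (π x a / π' x a)

end MDP

/-- The record of one round: the state, the action played in it, the next state that is observed,
and whether the state was then reset to the initial distribution. -/
structure Record (X A : Type*) where
  state : X
  action : A
  next : X
  reset : Bool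

instance {X A : Type*} : MeasurableSpace (Record X A) := ⊤

instance {X A : Type*} : DiscreteMeasurableSpace (Record X A) := ⟨fun _ => trivial⟩

instance {X A : Type*} [Finite X] [Finite A] : Finite (Record X A) :=
  Finite.of_injective (fun z : Record X A => (z.state, z.action, z.next, z.reset)) (by
    rintro ⟨x, a, y, b⟩ ⟨x', a', y', b'⟩ h
    simp only [Prod.mk.injEq] at h
    obtain ⟨rfl, rfl, rfl, rfl⟩ := h
    rfl)

/-- The inputs and the subroutines of the algorithm. The nominal transition model (any real-valued
kernel) and the exploration bonuses are arbitrary functions of all the data gathered before the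
start of the epoch, given as the list of the records of the past rounds, most recent first. -/
structure Algorithm (X A : Type*) [Fintype A] where
  /-- the learning rate -/
  η : ℝ
  /-- the initial value -/
  V₀ : X → ℝ
  /-- the initial policy -/
  π₀ : Policy X A
  transitionEstimate : List (Record X A) → X → A → X → ℝ
  bonus : List (Record X A) → X → A → ℝ

section softmax

variable {X A : Type*} [Fintype A]

/-- The softmax value `(1/η) log ∑ₐ π(a|x) exp(η Q(x,a))`. -/
def softValue (η : ℝ) (π : Policy X A) (Q : X → A → ℝ) (x : X) : ℝ :=
  1 / η * Real.log (∑ a, π x a * Real.exp (η * Q x a))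

theorem softmax_mem (η : ℝ) (π : Policy X A) (Q : X → A → ℝ) (x : X) :
    (fun a => π x a * Real.exp (η * (Q x a - softValue η π Q x))) ∈ stdSimplex ℝ A := by
  refine ⟨fun a => mul_nonneg ((π x).2.1 a) (Real.exp_pos _).le, ?_⟩
  have hsum : ∑ a, π x a = 1 := (π x).2.2
  rcases eq_or_ne η 0 with h | h
  · simp [h, hsum]
  · have hpos : 0 < ∑ a, π x a * Real.exp (η * Q x a) := by
      obtain ⟨a, -, ha⟩ : ∃ a ∈ Finset.univ, (0 : ℝ) < π x a := by
        by_contra! hc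
        linarith [Finset.sum_nonpos hc]
      exact Finset.sum_pos' (fun b _ => mul_nonneg ((π x).2.1 b) (Real.exp_pos _).le)
        ⟨a, Finset.mem_univ a, mul_pos ha (Real.exp_pos _)⟩
    have hv : η * softValue η π Q x = Real.log (∑ a, π x a * Real.exp (η * Q x a)) := by
      unfold softValue
      field_simp
    simp only [mul_sub, hv, Real.exp_sub, Real.exp_log hpos]
    simp only [← mul_div_assoc, ← Finset.sum_div]
    exact div_self hpos.ne'

/-- The policy update `π(a|x) exp(η (Q(x,a) - V(x)))`, with `V` the softmax value. -/
def softPolicy (η : ℝ) (π : Policy X A) (Q : X → A → ℝ) : Policy X A :=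
  fun x => ⟨fun a => π x a * Real.exp (η * (Q x a - softValue η π Q x)), softmax_mem η π Q x⟩

end softmax

/-- The quantities computed at the beginning of epoch `k`: the value `V_k`, the policy `π_k`, the
nominal model `P̂_k`, the bonus `CB_k` and the next action-value estimate `Q_{k+1}`. -/
structure Epoch (X A : Type*) [Fintype A] where
  V : X → ℝ
  π : Policy X A
  Phat : X → A → X → ℝ
  CB : X → A → ℝ
  Qnext : X → A → ℝ

section run

variable {X A : Type*} [Fintype X] [Fintype A] (M : MDP X A) (alg : Algorithm X A)

/-- The start of epoch `k`, from the data `D` gathered so far, the policy `π_{k-1}` and the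
action-value estimate `Q_k`. -/
def startEpoch (D : List (Record X A)) (π : Policy X A) (Q : X → A → ℝ) : Epoch X A where
  V := softValue alg.η π Q
  π := softPolicy alg.η π Q
  Phat := alg.transitionEstimate D
  CB := alg.bonus D
  Qnext := fun x a =>
    max (min (M.r x a + alg.bonus D x a
      + M.γ * ∑ x', alg.transitionEstimate D x a x' * softValue alg.η π Q x') M.H) 0

/-- The epoch to which the next round belongs, given the records of the past rounds (most recent
first): a new epoch starts after each reset. -/
def epochAfter : List (Record X A) → Epoch X A
  | [] => startEpoch M alg [] alg.π₀ (fun x _ => alg.V₀ x)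
  | z :: h =>
    if z.reset then startEpoch M alg (z :: h) (epochAfter h).π (epochAfter h).Qnext
    else epochAfter h

/-- The law of the state in which the next round is played. -/
def nextState : List (Record X A) → PMF X
  | [] => toPMF M.ν₀
  | z :: _ => if z.reset then toPMF M.ν₀ else PMF.pure z.next

/-- The reset coin: `true` with probability `1 - γ`. -/
def resetCoin : PMF Bool :=
  PMF.ofFintype (fun b => ENNReal.ofReal (if b then 1 - M.γ else M.γ)) (by
    have h := M.γ_pos
    have h' := M.γ_lt_one
    simp [← ENNReal.ofReal_add (sub_nonneg.2 h'.le) h.le])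

/-- The law of the record of the next round, given the records of the past rounds: the action is
drawn from the policy of the current epoch, the next state from the true transition function, and
the reset coin is tossed independently. -/
def nextRecord (h : List (Record X A)) : PMF (Record X A) :=
  (nextState M h).bind fun x =>
    (toPMF ((epochAfter M alg h).π x)).bind fun a =>
      (toPMF (M.P x a)).bind fun y =>
        (resetCoin M).bind fun b => PMF.pure ⟨x, a, y, b⟩

/-- The law of the infinite sequence of records when the algorithm is run for ever;
the term of index `n` is the record of round `t = n + 1`. -/
def runLaw : Measure (ℕ → Record X A) :=
  haveI (n : ℕ) : IsMarkovKernel (Kernel.ofFunOfCountable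
      fun h : (i : Finset.Iic n) → Record X A =>
        (nextRecord M alg (List.ofFn fun i : Fin (n + 1) =>
          h ⟨i, Finset.mem_Iic.2 (Nat.lt_succ_iff.1 i.2)⟩).reverse).toMeasure) :=
    ⟨fun _ => PMF.toMeasure.isProbabilityMeasure _⟩
  Kernel.trajMeasure (X := fun _ => Record X A) (nextRecord M alg []).toMeasure
    fun n => Kernel.ofFunOfCountable
      fun h : (i : Finset.Iic n) → Record X A =>
        (nextRecord M alg (List.ofFn fun i : Fin (n + 1) =>
          h ⟨i, Finset.mem_Iic.2 (Nat.lt_succ_iff.1 i.2)⟩).reverse).toMeasure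

/-- The records of the first `n` rounds, most recent first. -/
def history (ω : ℕ → Record X A) (n : ℕ) : List (Record X A) :=
  (List.ofFn fun i : Fin n => ω i).reverse

/-- The epoch to which round `n + 1` belongs. -/
def epochOf (ω : ℕ → Record X A) (n : ℕ) : Epoch X A := epochAfter M alg (history ω n)

/-- The bonuses of an epoch are valid: `|⟨γ P(·|x,a) - γ P̂_k(·|x,a), V_k⟩| ≤ CB_k(x,a)`. -/
def Epoch.Valid (e : Epoch X A) : Prop :=
  ∀ x a, |∑ x', (M.γ * M.P x a x' - M.γ * e.Phat x a x') * e.V x'| ≤ e.CB x a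

/-- The first round `T⁺ ≥ T` that ends with a reset. -/
def lastRound (T : ℕ) (ω : ℕ → Record X A) : ℕ :=
  sInf {t | T ≤ t ∧ ∃ n, t = n + 1 ∧ (ω n).reset = true}

/-- The sum of the instantaneous regrets of the rounds `1, …, T` with respect to the policy
`πstar`. -/
def regretSum (πstar : Policy X A) (T : ℕ) (ω : ℕ → Record X A) : ℝ :=
  ∑ n ∈ Finset.range T, (M.ret πstar - M.ret (epochOf M alg ω n).π)

/-- The sum of the bonuses `CB_t(X_t, A_t)` over the rounds `1, …, T⁺`. -/
def bonusSum (T : ℕ) (ω : ℕ → Record X A) : ℝ :=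
  ∑ n ∈ Finset.range (lastRound T ω), (epochOf M alg ω n).CB (ω n).state (ω n).action

end run

end

end RaviUCB

/-! Fix an epoch with policy `π_k`, value `V_k` and next estimate `Q_{k+1}`. Valid bonuses sandwich
`Q_{k+1}` between `r + γPV_k` and `r + 2CB_k + γPV_k`. Integrating the lower bound against `μ*` and
the upper one against `μ^{π_k}`, and using the flow equations, bounds the regret of `π_k` by
`2⟨μ^{π_k}, CB_k⟩` plus a gap that involves only `Q_{k+1}` and `V_k` (`Epoch.Regular.regret_le`).

The gap is a mirror descent term. Since `log (π_{k+1}/π_k) = η(Q_{k+1} - V_{k+1})`, the part under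
`μ*` is an exact decrease of relative entropy. The part under `μ^{π_k}` requires that a softmax step
move policies and occupancy measures by `O(η)`; this rests on the fact that the derivative of an
exponentially tilted mean is a covariance (`tilt_mean_sub_le`). Hence the gap is at most the
decrease of a potential plus `H³η/4` (`Epoch.Regular.gap_le`). The potential starts at `KL/η` and
never falls below `-H`.

The passage from occupancy measures to the trajectory uses the resets: stopping with probability `1
- γ` per round is discounting, so an epoch started from `ν₀` collects `H⟨μ^{π_k}, g⟩` of any `g` on
average. With `g = 2CB_k` minus the regret of `π_k`, the rewards collected up to `T⁺`, plus the
value still to come in the current epoch, minus the values of the epochs begun so far, form a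
martingale (`stepMean_compensated`). The epochs that start by round `T` number `1 + (T-1)(1-γ)` on
average. The rounds after `T` may be included because every instantaneous regret is nonnegative.

Together these give a bound with main terms `H·KL/η` and `(H+T-1)H³η/4`. For `T ≥ H - 1` the latter
is at most `TH³η/2`, which `η` balances; for smaller `T` the regret is at most `T`. -/

namespace RaviUCB

noncomputable section

/-! ### Covariances and exponential tilting on a finite simplex -/

section simplex

variable {ι : Type*} [Fintype ι] (p : stdSimplex ℝ ι)

theorem simplex_nonneg (i : ι) : 0 ≤ p i := p.2.1 i

theorem simplex_sum : ∑ i, p i = 1 := p.2.2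

theorem simplex_mean_le {f : ι → ℝ} {B : ℝ} (h : ∀ i, f i ≤ B) : ∑ i, p i * f i ≤ B := by
  calc ∑ i, p i * f i ≤ ∑ i, p i * B :=
        Finset.sum_le_sum fun i _ => mul_le_mul_of_nonneg_left (h i) (simplex_nonneg p i)
    _ = B := by rw [← Finset.sum_mul, simplex_sum, one_mul]

theorem le_simplex_mean {f : ι → ℝ} {B : ℝ} (h : ∀ i, B ≤ f i) : B ≤ ∑ i, p i * f i := by
  calc B = ∑ i, p i * B := by rw [← Finset.sum_mul, simplex_sum, one_mul]
    _ ≤ ∑ i, p i * f i :=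
        Finset.sum_le_sum fun i _ => mul_le_mul_of_nonneg_left (h i) (simplex_nonneg p i)

theorem simplex_exists_pos : ∃ i, 0 < p i := by
  by_contra! hc
  linarith [Finset.sum_nonpos fun i (_ : i ∈ Finset.univ) => hc i, simplex_sum p]

/-- The covariance of two functions with values in `[-1, 1]` is at most one. -/
theorem simplex_cov_le_one {u v : ι → ℝ} (hu : ∀ i, u i ^ 2 ≤ 1) (hv : ∀ i, v i ^ 2 ≤ 1) :
    ∑ i, p i * (u i * v i) - (∑ i, p i * u i) * ∑ i, p i * v i ≤ 1 := by
  -- Since `u - v` has nonnegative variance, the covariance is at most half the sum of the variances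
  -- of `u` and `v`.
  have h : 0 ≤ ∑ i, p i * (u i - v i - (∑ i, p i * u i - ∑ i, p i * v i)) ^ 2 :=
    Finset.sum_nonneg fun i _ => mul_nonneg (simplex_nonneg p i) (sq_nonneg _)
  have hU := simplex_mean_le p hu
  have hV := simplex_mean_le p hv
  set U := ∑ i, p i * u i with hUdef
  set W := ∑ i, p i * v i with hWdef
  have key : ∑ i, p i * (u i - v i - (U - W)) ^ 2 = ∑ i, p i * u i ^ 2 + ∑ i, p i * v i ^ 2
      - 2 * ∑ i, p i * (u i * v i) - (U - W) ^ 2 := by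
    have e : ∀ i, p i * (u i - v i - (U - W)) ^ 2 = p i * u i ^ 2 + p i * v i ^ 2
        - 2 * (p i * (u i * v i)) - 2 * (U - W) * (p i * u i) + 2 * (U - W) * (p i * v i)
        + (U - W) ^ 2 * p i := fun i => by ring
    simp only [e, Finset.sum_add_distrib, Finset.sum_sub_distrib, ← Finset.mul_sum, simplex_sum,
      ← hUdef, ← hWdef]
    ring
  rw [key] at h
  nlinarith [sq_nonneg U, sq_nonneg W, sq_nonneg (U + W), sq_nonneg (U - W)]

/-- The maps `t ↦ 2t/D - 1` carry `[0, D]` to `[-1, 1]` and multiply the covariance by `4/(BC)`. -/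
theorem simplex_cov_le {f q : ι → ℝ} {B C : ℝ} (hB : 0 < B) (hC : 0 < C)
    (hf : ∀ i, f i ∈ Set.Icc 0 B) (hq : ∀ i, q i ∈ Set.Icc 0 C) :
    ∑ i, p i * (f i * q i) - (∑ i, p i * f i) * ∑ i, p i * q i ≤ B * C / 4 := by
  have aux : ∀ {t D : ℝ}, 0 < D → t ∈ Set.Icc 0 D → (2 * t / D - 1) ^ 2 ≤ 1 := by
    intro t D hD ht
    have h1 : 0 ≤ 2 * t / D := by have := ht.1; positivity
    have h2 : 2 * t / D ≤ 2 := by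
      rw [div_le_iff₀ hD]; linarith [ht.2]
    nlinarith
  have h := simplex_cov_le_one p (u := fun i => 2 * f i / B - 1) (v := fun i => 2 * q i / C - 1)
    (fun i => aux hB (hf i)) (fun i => aux hC (hq i))
  have e1 : ∑ i, p i * (2 * f i / B - 1) = 2 / B * ∑ i, p i * f i - 1 := by
    have e : ∀ i, p i * (2 * f i / B - 1) = 2 / B * (p i * f i) - p i := fun i => by ring
    simp only [e, Finset.sum_sub_distrib, ← Finset.mul_sum, simplex_sum]
  have e2 : ∑ i, p i * (2 * q i / C - 1) = 2 / C * ∑ i, p i * q i - 1 := by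
    have e : ∀ i, p i * (2 * q i / C - 1) = 2 / C * (p i * q i) - p i := fun i => by ring
    simp only [e, Finset.sum_sub_distrib, ← Finset.mul_sum, simplex_sum]
  have e3 : ∑ i, p i * ((2 * f i / B - 1) * (2 * q i / C - 1))
      = 4 / (B * C) * ∑ i, p i * (f i * q i) - 2 / B * ∑ i, p i * f i
        - 2 / C * ∑ i, p i * q i + 1 := by
    have e : ∀ i, p i * ((2 * f i / B - 1) * (2 * q i / C - 1)) = 4 / (B * C) * (p i * (f i * q i))
        - 2 / B * (p i * f i) - 2 / C * (p i * q i) + p i := fun i => by field_simp; ring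
    simp only [e, Finset.sum_add_distrib, Finset.sum_sub_distrib, ← Finset.mul_sum, simplex_sum]
  rw [e1, e2, e3] at h
  have h' : 4 / (B * C) * (∑ i, p i * (f i * q i) - (∑ i, p i * f i) * ∑ i, p i * q i) ≤ 1 := by
    refine le_trans (le_of_eq ?_) h
    field_simp
    ring
  rw [div_mul_eq_mul_div, div_le_one (by positivity)] at h'
  linarith

/-- Exponential tilting by `η q`, with `q` in `[0, C]`, changes the mean of a function with values
in `[0, B]` by at most `η B C / 4`. -/
theorem tilt_mean_sub_le {f q : ι → ℝ} {B C η : ℝ} (hB : 0 < B) (hC : 0 < C) (hη : 0 ≤ η)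
    (hf : ∀ i, f i ∈ Set.Icc 0 B) (hq : ∀ i, q i ∈ Set.Icc 0 C) :
    (∑ i, p i * Real.exp (η * q i) * f i) / ∑ i, p i * Real.exp (η * q i) - ∑ i, p i * f i
      ≤ B * C / 4 * η := by
  set Z : ℝ → ℝ := fun s => ∑ i, p i * Real.exp (s * q i) with hZdef
  set N : ℝ → ℝ := fun s => ∑ i, p i * Real.exp (s * q i) * f i with hNdef
  have hZ : ∀ s, 0 < Z s := fun s => by
    obtain ⟨a, ha⟩ := simplex_exists_pos p
    exact Finset.sum_pos' (fun b _ => mul_nonneg (simplex_nonneg p b) (Real.exp_pos _).le)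
      ⟨a, Finset.mem_univ a, mul_pos ha (Real.exp_pos _)⟩
  have dE : ∀ s i, HasDerivAt (fun s => p i * Real.exp (s * q i))
      (p i * Real.exp (s * q i) * q i) s := fun s i => by
    have := (((hasDerivAt_id s).mul_const (q i)).exp).const_mul (p i)
    simpa [mul_assoc] using this
  have dZ : ∀ s, HasDerivAt Z (∑ i, p i * Real.exp (s * q i) * q i) s := fun s =>
    HasDerivAt.fun_sum fun i _ => dE s i
  have dN : ∀ s, HasDerivAt N (∑ i, p i * Real.exp (s * q i) * q i * f i) s := fun s =>
    HasDerivAt.fun_sum fun i _ => (dE s i).mul_const (f i)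
  have d : ∀ s, HasDerivAt (fun s => N s / Z s) _ s := fun s => (dN s).div (dZ s) (hZ s).ne'
  -- The derivative of the tilted mean is the covariance of `f` and `q` under the tilted
  -- distribution `p'`.
  have hd : ∀ s, deriv (fun s => N s / Z s) s ≤ B * C / 4 := fun s => by
    rw [(d s).deriv]
    let p' : stdSimplex ℝ ι := ⟨fun i => p i * Real.exp (s * q i) / Z s,
      fun i => div_nonneg (mul_nonneg (simplex_nonneg p i) (Real.exp_pos _).le) (hZ s).le, by
        rw [← Finset.sum_div]; exact div_self (hZ s).ne'⟩
    have h := simplex_cov_le p' hB hC hf hq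
    have hp' : ∀ i, p' i = p i * Real.exp (s * q i) / Z s := fun i => rfl
    refine le_trans (le_of_eq ?_) h
    have hz := (hZ s).ne'
    simp only [hp', div_mul_eq_mul_div, ← Finset.sum_div]
    have e : ∑ i, p i * Real.exp (s * q i) * (f i * q i)
        = ∑ i, p i * Real.exp (s * q i) * q i * f i :=
      Finset.sum_congr rfl fun i _ => by ring
    rw [e]
    change _ = _ - N s * _ / Z s
    field_simp
  have h := Convex.image_sub_le_mul_sub_of_deriv_le convex_univ
    (f := fun s => N s / Z s) (C := B * C / 4)
    (fun s _ => (d s).continuousAt.continuousWithinAt)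
    (fun s _ => (d s).differentiableAt.differentiableWithinAt)
    (fun s _ => hd s) 0 trivial η trivial hη
  have hZ0 : Z 0 = 1 := by simp [hZdef]
  have hN0 : N 0 = ∑ i, p i * f i := by simp [hNdef]
  simpa only [hZ0, hN0, div_one, sub_zero] using h

end simplex

/-! ### The softmax update -/

section softmax

variable {X A : Type*} [Fintype A] {η B : ℝ} (π : Policy X A) {Q : X → A → ℝ} (x : X)

theorem partition_pos (η : ℝ) (Q : X → A → ℝ) : 0 < ∑ a, π x a * Real.exp (η * Q x a) := by
  obtain ⟨a, ha⟩ := simplex_exists_pos (π x)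
  exact Finset.sum_pos' (fun b _ => mul_nonneg (simplex_nonneg _ b) (Real.exp_pos _).le)
    ⟨a, Finset.mem_univ a, mul_pos ha (Real.exp_pos _)⟩

theorem softPolicy_apply (η : ℝ) (Q : X → A → ℝ) (a : A) :
    softPolicy η π Q x a = π x a * Real.exp (η * (Q x a - softValue η π Q x)) := rfl

theorem softPolicy_eq_div (hη : η ≠ 0) (Q : X → A → ℝ) (a : A) :
    softPolicy η π Q x a
      = π x a * Real.exp (η * Q x a) / ∑ a, π x a * Real.exp (η * Q x a) := by
  have hv : η * softValue η π Q x = Real.log (∑ a, π x a * Real.exp (η * Q x a)) := by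
    unfold softValue
    field_simp
  rw [softPolicy_apply, mul_sub, hv, Real.exp_sub, Real.exp_log (partition_pos π x η Q),
    mul_div_assoc]

theorem softPolicy_pos {a : A} (h : 0 < π x a) (Q : X → A → ℝ) : 0 < softPolicy η π Q x a :=
  mul_pos h (Real.exp_pos _)

theorem softPolicy_mean_eq (hη : η ≠ 0) (Q : X → A → ℝ) (f : A → ℝ) :
    ∑ a, softPolicy η π Q x a * f a = (∑ a, π x a * Real.exp (η * Q x a) * f a)
      / ∑ a, π x a * Real.exp (η * Q x a) := by
  simp only [softPolicy_eq_div π x hη, div_mul_eq_mul_div, ← Finset.sum_div]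

theorem softPolicy_mean_sub_le (hη : 0 < η) {C : ℝ} (hB : 0 < B) (hC : 0 < C) {f : A → ℝ}
    (hf : ∀ a, f a ∈ Set.Icc 0 B) (hQ : ∀ a, Q x a ∈ Set.Icc 0 C) :
    ∑ a, softPolicy η π Q x a * f a - ∑ a, π x a * f a ≤ B * C / 4 * η := by
  rw [softPolicy_mean_eq π x hη.ne']
  exact tilt_mean_sub_le (π x) hB hC hη.le hf hQ

theorem softValue_nonneg (hη : 0 < η) (hQ : ∀ a, 0 ≤ Q x a) : 0 ≤ softValue η π Q x := by
  unfold softValue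
  refine mul_nonneg (by positivity) (Real.log_nonneg ?_)
  exact le_simplex_mean (π x) fun a => Real.one_le_exp (mul_nonneg hη.le (hQ a))

theorem softValue_le (hη : 0 < η) (hQ : ∀ a, Q x a ≤ B) : softValue η π Q x ≤ B := by
  unfold softValue
  rw [one_div_mul_eq_div, div_le_iff₀ hη, Real.log_le_iff_le_exp (partition_pos π x η Q)]
  exact simplex_mean_le (π x) fun a => Real.exp_le_exp.2 (by nlinarith [hQ a])

/-- The Gibbs variational inequality. -/
theorem softValue_le_mean (hη : 0 < η) (Q : X → A → ℝ) :
    softValue η π Q x ≤ ∑ a, softPolicy η π Q x a * Q x a := by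
  have h : ∀ a, softPolicy η π Q x a - π x a
      ≤ η * (softPolicy η π Q x a * Q x a - softPolicy η π Q x a * softValue η π Q x) := by
    intro a
    set y := η * (Q x a - softValue η π Q x) with hy
    -- Weighted by `π x a` and summed, this becomes the nonnegativity of the relative entropy of the
    -- new policy with respect to the old one, which equals `η` times the claimed difference.
    have h1 : Real.exp y - 1 ≤ Real.exp y * y := by
      have h2 := Real.add_one_le_exp (-y)
      have h3 : Real.exp y * Real.exp (-y) = 1 := by rw [← Real.exp_add]; simp
      nlinarith [Real.exp_pos y]
    have h4 := mul_le_mul_of_nonneg_left h1 (simplex_nonneg (π x) a)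
    rw [softPolicy_apply, ← hy]
    calc π x a * Real.exp y - π x a = π x a * (Real.exp y - 1) := by ring
      _ ≤ π x a * (Real.exp y * y) := h4
      _ = _ := by rw [hy]; ring
  have := Finset.sum_le_sum fun a (_ : a ∈ Finset.univ) => h a
  rw [Finset.sum_sub_distrib, ← Finset.mul_sum, Finset.sum_sub_distrib, ← Finset.sum_mul,
    simplex_sum, simplex_sum, one_mul, sub_self] at this
  nlinarith

end softmax

/-! ### Occupancy measures and Bellman evaluation equations -/

namespace MDP

variable {X A : Type*} [Fintype X] [Fintype A] (M : MDP X A)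

theorem one_sub_γ_pos : 0 < 1 - M.γ := sub_pos.2 M.γ_lt_one

theorem H_pos : 0 < M.H := one_div_pos.2 M.one_sub_γ_pos

theorem one_sub_γ_mul_H : (1 - M.γ) * M.H = 1 := mul_one_div_cancel M.one_sub_γ_pos.ne'

theorem one_le_H : 1 ≤ M.H := by
  have := M.one_sub_γ_mul_H
  nlinarith [M.H_pos, M.γ_pos]

theorem stateProb_nonneg (π : Policy X A) : ∀ t x, 0 ≤ M.stateProb π t x
  | 0, x => simplex_nonneg M.ν₀ x
  | t + 1, _ => Finset.sum_nonneg fun x _ => Finset.sum_nonneg fun a _ =>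
      mul_nonneg (mul_nonneg (stateProb_nonneg π t x) (simplex_nonneg _ a)) (simplex_nonneg _ _)

/-- One step of the state process, in dual form. -/
theorem stateProb_succ_mean (π : Policy X A) (t : ℕ) (f : X → ℝ) :
    ∑ y, M.stateProb π (t + 1) y * f y
      = ∑ x, M.stateProb π t x * ∑ a, π x a * ∑ y, M.P x a y * f y := by
  simp only [stateProb, Finset.sum_mul, Finset.mul_sum]
  rw [Finset.sum_comm]
  refine Finset.sum_congr rfl fun x _ => ?_
  rw [Finset.sum_comm]
  exact Finset.sum_congr rfl fun a _ => Finset.sum_congr rfl fun y _ => by ring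

theorem stateProb_sum (π : Policy X A) (t : ℕ) : ∑ x, M.stateProb π t x = 1 := by
  induction t with
  | zero => exact simplex_sum M.ν₀
  | succ t ih =>
    have h := M.stateProb_succ_mean π t fun _ => 1
    simpa only [mul_one, simplex_sum, ih] using h

theorem stateProb_le_one (π : Policy X A) (t : ℕ) (x : X) : M.stateProb π t x ≤ 1 :=
  (Finset.single_le_sum (fun y _ => M.stateProb_nonneg π t y) (Finset.mem_univ x)).trans_eq
    (M.stateProb_sum π t)

theorem summable_stateProb (π : Policy X A) (x : X) :
    Summable fun t : ℕ => M.γ ^ t * M.stateProb π t x :=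
  Summable.of_nonneg_of_le
    (fun t => mul_nonneg (pow_nonneg M.γ_pos.le t) (M.stateProb_nonneg π t x))
    (fun t => mul_le_of_le_one_right (pow_nonneg M.γ_pos.le t) (M.stateProb_le_one π t x))
    (summable_geometric_of_lt_one M.γ_pos.le M.γ_lt_one)

theorem stateOcc_nonneg (π : Policy X A) (x : X) : 0 ≤ M.stateOcc π x :=
  mul_nonneg M.one_sub_γ_pos.le
    (tsum_nonneg fun t => mul_nonneg (pow_nonneg M.γ_pos.le t) (M.stateProb_nonneg π t x))

theorem hasSum_stateOcc_mean (π : Policy X A) (f : X → ℝ) :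
    HasSum (fun t : ℕ => (1 - M.γ) * (M.γ ^ t * ∑ x, M.stateProb π t x * f x))
      (∑ x, M.stateOcc π x * f x) := by
  have h : HasSum (fun t : ℕ => ∑ x, (1 - M.γ) * (M.γ ^ t * M.stateProb π t x) * f x)
      (∑ x, M.stateOcc π x * f x) :=
    hasSum_sum fun x _ => ((M.summable_stateProb π x).hasSum.mul_left _).mul_right _
  refine h.congr_fun fun t => ?_
  simp only [Finset.mul_sum]
  exact Finset.sum_congr rfl fun x _ => by ring

theorem stateOcc_sum (π : Policy X A) : ∑ x, M.stateOcc π x = 1 := by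
  have h := M.hasSum_stateOcc_mean π fun _ => 1
  simp only [mul_one, stateProb_sum] at h
  have h' := (hasSum_geometric_of_lt_one M.γ_pos.le M.γ_lt_one).mul_left (1 - M.γ)
  rw [mul_inv_cancel₀ M.one_sub_γ_pos.ne'] at h'
  exact h.unique h'

/-- The Bellman flow equation, in dual form. -/
theorem stateOcc_flow (π : Policy X A) (f : X → ℝ) :
    ∑ x, M.stateOcc π x * f x = (1 - M.γ) * ∑ x, M.ν₀ x * f x
      + M.γ * ∑ x, M.stateOcc π x * ∑ a, π x a * ∑ y, M.P x a y * f y := by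
  have h := M.hasSum_stateOcc_mean π f
  rw [← hasSum_nat_add_iff' 1] at h
  have h' := (M.hasSum_stateOcc_mean π fun x => ∑ a, π x a * ∑ y, M.P x a y * f y).mul_left M.γ
  simp only [stateProb_succ_mean, Finset.sum_range_one, pow_zero, one_mul] at h
  have e := h.unique (h'.congr_fun fun t => by ring)
  have e0 : ∑ x, M.stateProb π 0 x * f x = ∑ x, M.ν₀ x * f x := rfl
  rw [e0] at e
  linarith

theorem stateOcc_mean_le (π : Policy X A) {f : X → ℝ} {B : ℝ} (h : ∀ x, f x ≤ B) :
    ∑ x, M.stateOcc π x * f x ≤ B :=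
  simplex_mean_le ⟨M.stateOcc π, M.stateOcc_nonneg π, M.stateOcc_sum π⟩ h

theorem le_stateOcc_mean (π : Policy X A) {f : X → ℝ} {B : ℝ} (h : ∀ x, B ≤ f x) :
    B ≤ ∑ x, M.stateOcc π x * f x :=
  le_simplex_mean ⟨M.stateOcc π, M.stateOcc_nonneg π, M.stateOcc_sum π⟩ h

theorem occ_mean (π : Policy X A) (f : X → A → ℝ) :
    ∑ x, ∑ a, M.occ π x a * f x a = ∑ x, M.stateOcc π x * ∑ a, π x a * f x a := by
  simp only [occ, Finset.mul_sum, mul_assoc]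

theorem ret_eq (π : Policy X A) :
    M.ret π = ∑ x, M.stateOcc π x * ∑ a, π x a * M.r x a := M.occ_mean π M.r

theorem ret_nonneg (π : Policy X A) : 0 ≤ M.ret π := by
  rw [ret_eq]
  exact M.le_stateOcc_mean π fun x => le_simplex_mean _ fun a => M.r_nonneg x a

theorem ret_le_one (π : Policy X A) : M.ret π ≤ 1 := by
  rw [ret_eq]
  exact M.stateOcc_mean_le π fun x => simplex_mean_le _ fun a => M.r_le_one x a

theorem nonempty_states (M : MDP X A) : Nonempty X :=
  let ⟨x, _⟩ := simplex_exists_pos M.ν₀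
  ⟨x⟩

/-- A solution of a Bellman evaluation equation is bounded by the effective horizon times the
bound on the rewards. -/
theorem bellman_le (π : Policy X A) {g : X → A → ℝ} {W : X → ℝ} {B : ℝ} (hg : ∀ x a, g x a ≤ B)
    (hW : ∀ x, W x = ∑ a, π x a * (g x a + M.γ * ∑ y, M.P x a y * W y)) (x : X) :
    W x ≤ B * M.H := by
  have := M.nonempty_states
  obtain ⟨z, hz⟩ := Finite.exists_max W
  have h : W z ≤ B + M.γ * W z := by
    conv_lhs => rw [hW]
    exact simplex_mean_le _ fun a => add_le_add (hg z a)
      (mul_le_mul_of_nonneg_left (simplex_mean_le _ hz) M.γ_pos.le)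
  refine (hz x).trans ?_
  rw [H, mul_one_div, le_div_iff₀ M.one_sub_γ_pos]
  linarith

theorem le_bellman (π : Policy X A) {g : X → A → ℝ} {W : X → ℝ} {B : ℝ} (hg : ∀ x a, B ≤ g x a)
    (hW : ∀ x, W x = ∑ a, π x a * (g x a + M.γ * ∑ y, M.P x a y * W y)) (x : X) :
    B * M.H ≤ W x := by
  have h := M.bellman_le π (g := fun x a => -g x a) (W := fun x => -W x) (B := -B)
    (fun x a => neg_le_neg (hg x a)) (fun x => by
      conv_lhs => rw [hW]
      rw [← Finset.sum_neg_distrib]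
      refine Finset.sum_congr rfl fun a _ => ?_
      simp only [mul_neg, Finset.sum_neg_distrib]
      ring) x
  linarith

/-- The operator `f ↦ f - γP^π f` is injective by the maximum principle (`bellman_le` and
`le_bellman` with zero reward), hence surjective in finite dimension. -/
theorem exists_bellman (π : Policy X A) (g : X → A → ℝ) :
    ∃ W : X → ℝ, ∀ x, W x = ∑ a, π x a * (g x a + M.γ * ∑ y, M.P x a y * W y) := by
  let L : (X → ℝ) →ₗ[ℝ] (X → ℝ) :=
    { toFun := fun f x => f x - ∑ a, π x a * (M.γ * ∑ y, M.P x a y * f y)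
      map_add' := fun f f' => by
        ext x
        simp only [Pi.add_apply, mul_add, Finset.sum_add_distrib]
        ring
      map_smul' := fun c f => by
        ext x
        simp only [Pi.smul_apply, smul_eq_mul, RingHom.id_apply, mul_sub, Finset.mul_sum]
        congr 1
        exact Finset.sum_congr rfl fun a _ => Finset.sum_congr rfl fun y _ => by ring }
  have hL : ∀ f x, L f x = f x - ∑ a, π x a * (M.γ * ∑ y, M.P x a y * f y) := fun _ _ => rfl
  have hinj : Function.Injective L := by
    refine (injective_iff_map_eq_zero L).2 fun f hf => ?_
    have hW : ∀ x, f x = ∑ a, π x a * (0 + M.γ * ∑ y, M.P x a y * f y) := fun x => by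
      have := congrFun hf x
      rw [hL, Pi.zero_apply] at this
      simp only [zero_add]
      linarith
    ext x
    have h1 := M.bellman_le π (g := fun _ _ => 0) (fun _ _ => le_rfl) hW x
    have h2 := M.le_bellman π (g := fun _ _ => 0) (fun _ _ => le_rfl) hW x
    simp only [Pi.zero_apply]
    linarith
  obtain ⟨W, hW⟩ := LinearMap.surjective_of_injective hinj fun x => ∑ a, π x a * g x a
  refine ⟨W, fun x => ?_⟩
  have := congrFun hW x
  rw [hL] at this
  simp only [mul_add, Finset.sum_add_distrib]
  linarith

/-- The value function of a policy for the reward function `g`. -/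
def value (π : Policy X A) (g : X → A → ℝ) : X → ℝ := (M.exists_bellman π g).choose

theorem value_eq (π : Policy X A) (g : X → A → ℝ) (x : X) :
    M.value π g x = ∑ a, π x a * (g x a + M.γ * ∑ y, M.P x a y * M.value π g y) :=
  (M.exists_bellman π g).choose_spec x

/-- This is the flow equation tested on the value function. It links what an epoch collects from
`ν₀` with the occupancy measure of its policy. -/
theorem initial_value (π : Policy X A) (g : X → A → ℝ) :
    ∑ x, M.ν₀ x * M.value π g x = M.H * ∑ x, M.stateOcc π x * ∑ a, π x a * g x a := by
  have h := M.stateOcc_flow π (M.value π g)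
  have e : ∀ x, M.stateOcc π x * M.value π g x = M.stateOcc π x * ∑ a, π x a * g x a
      + M.γ * (M.stateOcc π x * ∑ a, π x a * ∑ y, M.P x a y * M.value π g y) := fun x => by
    conv_lhs => rw [value_eq]
    simp only [mul_add, Finset.sum_add_distrib, mul_left_comm _ M.γ, ← Finset.mul_sum]
  simp only [e, Finset.sum_add_distrib, ← Finset.mul_sum] at h
  have h' := M.one_sub_γ_mul_H
  have h2 : ∑ x, M.stateOcc π x * ∑ a, π x a * g x a
      = (1 - M.γ) * ∑ x, M.ν₀ x * M.value π g x := by linarith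
  rw [h2, ← mul_assoc, mul_comm M.H, h', one_mul]

theorem value_le (π : Policy X A) {g : X → A → ℝ} {B : ℝ} (hg : ∀ x a, g x a ≤ B) (x : X) :
    M.value π g x ≤ B * M.H := M.bellman_le π hg (M.value_eq π g) x

theorem le_value (π : Policy X A) {g : X → A → ℝ} {B : ℝ} (hg : ∀ x a, B ≤ g x a) (x : X) :
    B * M.H ≤ M.value π g x := M.le_bellman π hg (M.value_eq π g) x

/-- A softmax update changes the occupancy measure by little. -/
theorem stateOcc_softPolicy_sub_le {η : ℝ} (hη : 0 < η) (π : Policy X A) {Q : X → A → ℝ}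
    (hQ : ∀ x a, Q x a ∈ Set.Icc 0 M.H) {V : X → ℝ} (hV : ∀ x, V x ∈ Set.Icc 0 M.H) :
    ∑ x, M.stateOcc (softPolicy η π Q) x * V x - ∑ x, M.stateOcc π x * V x
      ≤ M.γ * (M.H ^ 3 / 4 * η) := by
  set π' := softPolicy η π Q with hπ'
  -- With `V` as reward and `W` its value under the new policy, `hflow` is a performance difference
  -- identity: the change of `⟨ν, V⟩` is `γ` times a mean under `stateOcc π` of `(π' - π)PW`. As `W`
  -- lies in `[0, H²]`, the tilting bound applies state by state.
  set W := M.value π' fun x _ => V x with hW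
  have h0 : ∀ x, 0 ≤ W x := fun x => by
    simpa using M.le_value π' (g := fun x _ => V x) (fun x _ => (hV x).1) x
  have h1 : ∀ x, W x ≤ M.H ^ 2 := fun x => by
    simpa [sq] using M.value_le π' (g := fun x _ => V x) (fun x _ => (hV x).2) x
  have hVW : ∀ x, V x = W x - M.γ * ∑ a, π' x a * ∑ y, M.P x a y * W y := fun x => by
    have := M.value_eq π' (fun x _ => V x) x
    simp only [mul_add, Finset.sum_add_distrib, ← Finset.sum_mul, simplex_sum, one_mul,
      mul_left_comm _ M.γ, ← Finset.mul_sum] at this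
    rw [hW]
    linarith
  have key : ∀ x, ∑ a, π' x a * ∑ y, M.P x a y * W y - ∑ a, π x a * ∑ y, M.P x a y * W y
      ≤ M.H ^ 3 / 4 * η := fun x => by
    refine (softPolicy_mean_sub_le π x hη (pow_pos M.H_pos 2) M.H_pos
      (f := fun a => ∑ y, M.P x a y * W y)
      (fun a => ⟨le_simplex_mean _ h0, simplex_mean_le _ h1⟩) (hQ x)).trans_eq ?_
    ring
  have hflow : ∀ p : Policy X A, ∑ x, M.stateOcc p x * V x
      = (1 - M.γ) * ∑ x, M.ν₀ x * W x + M.γ * ∑ x, M.stateOcc p x *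
        (∑ a, p x a * ∑ y, M.P x a y * W y - ∑ a, π' x a * ∑ y, M.P x a y * W y) := fun p => by
    have := M.stateOcc_flow p W
    have e : ∀ x, M.stateOcc p x * V x = M.stateOcc p x * W x
        - M.γ * (M.stateOcc p x * ∑ a, π' x a * ∑ y, M.P x a y * W y) := fun x => by
      rw [hVW]; ring
    simp only [e, Finset.sum_sub_distrib, mul_sub, ← Finset.mul_sum]
    rw [this]
    ring
  rw [hflow π, hflow π']
  have hneg := mul_le_mul_of_nonneg_left (M.stateOcc_mean_le π key) M.γ_pos.le
  simp only [mul_sub, Finset.sum_sub_distrib, sub_self, mul_zero,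
    Finset.sum_const_zero] at hneg ⊢
  linarith

/-! ### Relative entropy to the comparator -/

section relEntropy

variable {π πstar : Policy X A}

/-- Gibbs' inequality. -/
theorem condRelEntropy_nonneg (h : ∀ x a, 0 < M.occ πstar x a → 0 < π x a) :
    0 ≤ M.condRelEntropy πstar π := by
  refine Finset.sum_nonneg fun x _ => ?_
  rcases (M.stateOcc_nonneg πstar x).eq_or_lt with h0 | h0
  · rw [← h0, zero_mul]
  refine mul_nonneg h0.le ?_
  have key : ∀ a, πstar x a - π x a ≤ πstar x a * Real.log (πstar x a / π x a) := fun a => by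
    rcases (simplex_nonneg (πstar x) a).eq_or_lt with h1 | h1
    · rw [← h1]; simp
    have h2 := h x a (mul_pos h0 h1)
    have h3 := Real.one_sub_inv_le_log_of_pos (div_pos h1 h2)
    have h4 := mul_le_mul_of_nonneg_left h3 h1.le
    rw [inv_div, mul_sub, mul_div_cancel₀ _ h1.ne', mul_one] at h4
    exact h4
  have := Finset.sum_le_sum fun a (_ : a ∈ Finset.univ) => key a
  rwa [Finset.sum_sub_distrib, simplex_sum, simplex_sum, sub_self] at this

/-- The log-ratio of the two policies is exactly `η(Q - V)`, so there is no remainder. Pairs not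
charged by `πstar` contribute zero, which is why positivity of `π` is needed only on its support. -/
theorem condRelEntropy_sub_softPolicy {η : ℝ} (h : ∀ x a, 0 < M.occ πstar x a → 0 < π x a)
    (Q : X → A → ℝ) :
    M.condRelEntropy πstar π - M.condRelEntropy πstar (softPolicy η π Q)
      = η * (∑ x, ∑ a, M.occ πstar x a * Q x a
        - ∑ x, M.stateOcc πstar x * softValue η π Q x) := by
  rw [occ_mean, condRelEntropy, condRelEntropy, ← Finset.sum_sub_distrib,
    ← Finset.sum_sub_distrib, Finset.mul_sum]
  refine Finset.sum_congr rfl fun x _ => ?_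
  rcases (M.stateOcc_nonneg πstar x).eq_or_lt with h0 | h0
  · rw [← h0]; simp
  have key : ∀ a, πstar x a * Real.log (πstar x a / π x a)
      - πstar x a * Real.log (πstar x a / softPolicy η π Q x a)
      = η * (πstar x a * Q x a - πstar x a * softValue η π Q x) := fun a => by
    rcases (simplex_nonneg (πstar x) a).eq_or_lt with h1 | h1
    · rw [← h1]; simp
    have h2 := h x a (mul_pos h0 h1)
    rw [Real.log_div h1.ne' h2.ne', Real.log_div h1.ne' (softPolicy_pos π x h2 Q).ne',
      softPolicy_apply, Real.log_mul h2.ne' (Real.exp_pos _).ne', Real.log_exp]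
    ring
  have := Finset.sum_congr rfl fun a (_ : a ∈ Finset.univ) => key a
  rw [Finset.sum_sub_distrib, ← Finset.mul_sum, Finset.sum_sub_distrib, ← Finset.sum_mul,
    simplex_sum, one_mul] at this
  rw [← mul_sub, this]
  ring

theorem condRelEntropy_uniform_le (h : ∀ x a, π x a = 1 / (Fintype.card A : ℝ)) :
    M.condRelEntropy πstar π ≤ Real.log (Fintype.card A) := by
  refine M.stateOcc_mean_le πstar fun x => simplex_mean_le _ fun a => ?_
  have h1 : πstar x a ≤ 1 :=
    (Finset.single_le_sum (fun b _ => simplex_nonneg (πstar x) b)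
      (Finset.mem_univ a)).trans_eq (simplex_sum _)
  have hc : (0 : ℝ) < Fintype.card A := by
    exact_mod_cast Fintype.card_pos_iff.2 ⟨a⟩
  rcases (simplex_nonneg (πstar x) a).eq_or_lt with h0 | h0
  · rw [← h0]
    simpa using Real.log_natCast_nonneg _
  · rw [h, div_div_eq_mul_div, div_one]
    exact Real.log_le_log (mul_pos h0 hc) (mul_le_of_le_one_left hc.le h1)

end relEntropy

end MDP

/-! ### One epoch: optimism, regret and potential -/

section epoch

variable {X A : Type*} [Fintype X] [Fintype A] (M : MDP X A)

/-- The relations between the quantities of an epoch that the algorithm maintains, together with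
the fact that the policy of the epoch charges the actions of the comparator. -/
structure Epoch.Regular (πstar : Policy X A) (e : Epoch X A) : Prop where
  V_mem : ∀ x, e.V x ∈ Set.Icc 0 M.H
  Qnext_eq : ∀ x a, e.Qnext x a =
    max (min (M.r x a + e.CB x a + M.γ * ∑ x', e.Phat x a x' * e.V x') M.H) 0
  support : ∀ x a, 0 < M.occ πstar x a → 0 < e.π x a

variable {M} {πstar : Policy X A} {e : Epoch X A}

theorem Epoch.Regular.Qnext_mem (h : e.Regular M πstar) (x : X) (a : A) :
    e.Qnext x a ∈ Set.Icc 0 M.H := by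
  rw [h.Qnext_eq]
  exact ⟨le_max_right _ _, max_le (min_le_right _ _) M.H_pos.le⟩

theorem Epoch.Valid.CB_nonneg (hv : e.Valid M) (x : X) (a : A) : 0 ≤ e.CB x a :=
  (abs_nonneg _).trans (hv x a)

theorem Epoch.Valid.abs_le (hv : e.Valid M) (x : X) (a : A) :
    |M.γ * ∑ y, M.P x a y * e.V y - M.γ * ∑ y, e.Phat x a y * e.V y| ≤ e.CB x a := by
  refine le_of_eq_of_le ?_ (hv x a)
  rw [Finset.mul_sum, Finset.mul_sum, ← Finset.sum_sub_distrib]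
  exact congrArg abs (Finset.sum_congr rfl fun y _ => by ring)

/-- Optimism. -/
theorem Epoch.Regular.le_Qnext (h : e.Regular M πstar) (hv : e.Valid M) (x : X) (a : A) :
    M.r x a + M.γ * ∑ y, M.P x a y * e.V y ≤ e.Qnext x a := by
  have h1 := (abs_le.1 (hv.abs_le x a)).2
  have h2 : ∑ y, M.P x a y * e.V y ≤ M.H := simplex_mean_le _ fun y => (h.V_mem y).2
  rw [h.Qnext_eq]
  -- Truncation at `H` costs nothing because `1 + γH = H`.
  refine le_max_of_le_left (le_min (by linarith) ?_)
  have := M.r_le_one x a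
  have := mul_le_mul_of_nonneg_left h2 M.γ_pos.le
  linarith [M.one_sub_γ_mul_H]

/-- One `CB` is the bonus that was added, the other pays for the model error. Truncation at `0` is
harmless since every term on the right is nonnegative. -/
theorem Epoch.Regular.Qnext_le (h : e.Regular M πstar) (hv : e.Valid M) (x : X) (a : A) :
    e.Qnext x a ≤ M.r x a + 2 * e.CB x a + M.γ * ∑ y, M.P x a y * e.V y := by
  have h1 := (abs_le.1 (hv.abs_le x a)).1
  have h2 : 0 ≤ ∑ y, M.P x a y * e.V y := le_simplex_mean _ fun y => (h.V_mem y).1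
  rw [h.Qnext_eq]
  refine max_le ((min_le_left _ _).trans (by linarith)) ?_
  have := M.r_nonneg x a
  have := hv.CB_nonneg x a
  have := mul_nonneg M.γ_pos.le h2
  linarith

variable (M πstar) in
/-- The sum of the gaps `⟨μ* , Q_{k+1} - V_k⟩` and `⟨μ_k, V_k - Q_{k+1}⟩`. -/
def Epoch.gap (e : Epoch X A) : ℝ :=
  (∑ x, ∑ a, M.occ πstar x a * e.Qnext x a - ∑ x, M.stateOcc πstar x * e.V x)
    + (∑ x, M.stateOcc e.π x * e.V x - ∑ x, M.stateOcc e.π x * ∑ a, e.π x a * e.Qnext x a)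

theorem MDP.occ_mean_mono (π : Policy X A) {f g : X → A → ℝ} (h : ∀ x a, f x a ≤ g x a) :
    ∑ x, M.stateOcc π x * ∑ a, π x a * f x a ≤ ∑ x, M.stateOcc π x * ∑ a, π x a * g x a :=
  Finset.sum_le_sum fun x _ => mul_le_mul_of_nonneg_left
    (Finset.sum_le_sum fun a _ => mul_le_mul_of_nonneg_left (h x a) (simplex_nonneg _ a))
    (M.stateOcc_nonneg π x)

/-- The regret of one epoch is at most twice the mean bonus plus the gap. -/
theorem Epoch.Regular.regret_le (h : e.Regular M πstar) (hv : e.Valid M) :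
    M.ret πstar - M.ret e.π ≤ 2 * ∑ x, M.stateOcc e.π x * ∑ a, e.π x a * e.CB x a
      + e.gap M πstar := by
  have h1 := M.occ_mean_mono πstar (h.le_Qnext hv)
  have h2 := M.occ_mean_mono e.π (h.Qnext_le hv)
  have f1 := M.stateOcc_flow πstar e.V
  have f2 := M.stateOcc_flow e.π e.V
  -- The flow equations replace `γ⟨μ, PV⟩` by `⟨ν, V⟩ - (1-γ)⟨ν₀, V⟩`; the initial terms of the two
  -- policies cancel.
  have e2 : ∀ x a, e.π x a * (2 * e.CB x a) = 2 * (e.π x a * e.CB x a) := fun x a => by ring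
  simp only [mul_add, Finset.sum_add_distrib, mul_left_comm _ M.γ, ← Finset.mul_sum, e2,
    mul_left_comm _ (2 : ℝ)] at h1 h2
  rw [Epoch.gap, M.occ_mean, M.ret_eq, M.ret_eq]
  linarith

variable (M πstar) in
/-- The potential of the regularized updates. -/
def potential (η : ℝ) (π : Policy X A) (V : X → ℝ) : ℝ :=
  1 / η * M.condRelEntropy πstar π - ∑ x, M.stateOcc πstar x * V x + ∑ x, M.stateOcc π x * V x

/-- The gap of an epoch is controlled by the decrease of the potential. -/
theorem Epoch.Regular.gap_le (h : e.Regular M πstar) {η : ℝ} (hη : 0 < η) :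
    e.gap M πstar ≤ potential M πstar η e.π e.V
      - potential M πstar η (softPolicy η e.π e.Qnext) (softValue η e.π e.Qnext)
      + M.H ^ 3 / 4 * η := by
  set V' := softValue η e.π e.Qnext with hV'
  have h1 := M.condRelEntropy_sub_softPolicy (η := η) h.support e.Qnext
  have h2 := M.stateOcc_softPolicy_sub_le hη e.π h.Qnext_mem (V := V') fun x =>
    ⟨softValue_nonneg _ x hη fun a => (h.Qnext_mem x a).1,
      softValue_le _ x hη fun a => (h.Qnext_mem x a).2⟩
  -- The Gibbs inequality bounds `V'` by the mean of `Qnext` under the updated policy; tilting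
  -- brings it back to `e.π` at cost `H²η/4`.
  have h3 : ∑ x, M.stateOcc e.π x * V' x - ∑ x, M.stateOcc e.π x * ∑ a, e.π x a * e.Qnext x a
      ≤ M.H ^ 2 / 4 * η := by
    rw [← Finset.sum_sub_distrib]
    simp only [← mul_sub]
    refine M.stateOcc_mean_le e.π fun x => ?_
    have := softPolicy_mean_sub_le e.π x hη M.H_pos M.H_pos (h.Qnext_mem x) (h.Qnext_mem x)
    have := softValue_le_mean e.π x hη e.Qnext
    rw [sq]
    linarith
  -- The occupancy shift and the policy shift add up exactly, since `γH + 1 = H`.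
  have h4 : M.γ * (M.H ^ 3 / 4 * η) + M.H ^ 2 / 4 * η = M.H ^ 3 / 4 * η := by
    linear_combination (-(M.H ^ 2 / 4 * η)) * M.one_sub_γ_mul_H
  have h5 : 1 / η * M.condRelEntropy πstar e.π
      - 1 / η * M.condRelEntropy πstar (softPolicy η e.π e.Qnext)
      = ∑ x, ∑ a, M.occ πstar x a * e.Qnext x a - ∑ x, M.stateOcc πstar x * V' x := by
    rw [← mul_sub, h1, ← mul_assoc, one_div_mul_cancel hη.ne', one_mul]
  unfold Epoch.gap potential
  linarith

theorem neg_H_le_potential {η : ℝ} (hη : 0 < η) {π : Policy X A} {V : X → ℝ}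
    (hπ : ∀ x a, 0 < M.occ πstar x a → 0 < π x a) (hV : ∀ x, V x ∈ Set.Icc 0 M.H) :
    -M.H ≤ potential M πstar η π V := by
  have h1 := mul_nonneg (one_div_pos.2 hη).le (M.condRelEntropy_nonneg hπ)
  have h2 := M.stateOcc_mean_le πstar fun x => (hV x).2
  have h3 := M.le_stateOcc_mean π fun x => (hV x).1
  unfold potential
  linarith

variable (alg : Algorithm X A)

theorem regular_startEpoch (hη : 0 < alg.η) (D : List (Record X A)) {π : Policy X A}
    {Q : X → A → ℝ} (hQ : ∀ x a, Q x a ∈ Set.Icc 0 M.H)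
    (hπ : ∀ x a, 0 < M.occ πstar x a → 0 < π x a) :
    (startEpoch M alg D π Q).Regular M πstar where
  V_mem x := ⟨softValue_nonneg _ x hη fun a => (hQ x a).1,
    softValue_le _ x hη fun a => (hQ x a).2⟩
  Qnext_eq _ _ := rfl
  support x a h := softPolicy_pos π x (hπ x a h) Q

theorem epochAfter_cons_reset {z : Record X A} (hz : z.reset = true) (h : List (Record X A)) :
    epochAfter M alg (z :: h)
      = startEpoch M alg (z :: h) (epochAfter M alg h).π (epochAfter M alg h).Qnext := by
  simp [epochAfter, hz]

theorem epochAfter_cons {z : Record X A} (hz : z.reset = false) (h : List (Record X A)) :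
    epochAfter M alg (z :: h) = epochAfter M alg h := by
  simp [epochAfter, hz]

theorem regular_epochAfter (hη : 0 < alg.η) (hV₀ : ∀ x, alg.V₀ x = 0)
    (hπ : ∀ x a, 0 < M.occ πstar x a → 0 < alg.π₀ x a) (h : List (Record X A)) :
    (epochAfter M alg h).Regular M πstar := by
  induction h with
  | nil => exact regular_startEpoch alg hη [] (fun x _ => by simp [hV₀, M.H_pos.le]) hπ
  | cons z h ih =>
    cases hz : z.reset
    · rwa [epochAfter_cons alg hz]
    · rw [epochAfter_cons_reset alg hz]
      exact regular_startEpoch alg hη _ ih.Qnext_mem ih.support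

theorem epochAfter_nil_V (hV₀ : ∀ x, alg.V₀ x = 0) (x : X) : (epochAfter M alg []).V x = 0 := by
  simp [epochAfter, startEpoch, softValue, hV₀]

theorem epochAfter_nil_π (hV₀ : ∀ x, alg.V₀ x = 0) : (epochAfter M alg []).π = alg.π₀ := by
  funext x
  ext a
  have := epochAfter_nil_V (M := M) alg hV₀ x
  simp only [epochAfter, startEpoch] at this ⊢
  rw [softPolicy_apply, this, hV₀]
  simp

end epoch

/-! ### Finite probability mass functions as weighted sums -/

section pmf

variable {ι κ : Type*} [Fintype ι] [Fintype κ]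

theorem toPMF_toReal (p : stdSimplex ℝ ι) (i : ι) : (toPMF p i).toReal = p i :=
  ENNReal.toReal_ofReal (simplex_nonneg p i)

theorem pmf_bind_mean (p : PMF ι) (q : ι → PMF κ) (f : κ → ℝ) :
    ∑ b, ((p.bind q) b).toReal * f b = ∑ a, (p a).toReal * ∑ b, (q a b).toReal * f b := by
  have h : ∀ b, ((p.bind q) b).toReal = ∑ a, (p a).toReal * (q a b).toReal := fun b => by
    rw [PMF.bind_apply, tsum_fintype, ENNReal.toReal_sum fun a _ =>
      ENNReal.mul_ne_top (p.apply_ne_top a) ((q a).apply_ne_top b)]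
    simp only [ENNReal.toReal_mul]
  simp only [h, Finset.sum_mul, Finset.mul_sum]
  rw [Finset.sum_comm]
  exact Finset.sum_congr rfl fun a _ => Finset.sum_congr rfl fun b _ => mul_assoc _ _ _

theorem pmf_pure_mean (i : ι) (f : ι → ℝ) : ∑ b, (PMF.pure i b).toReal * f b = f i := by
  classical
  rw [Finset.sum_eq_single i (fun b _ hb => by simp [PMF.pure_apply, hb]) (by simp)]
  simp [PMF.pure_apply]

theorem pmf_sum_toReal (p : PMF ι) : ∑ i, (p i).toReal = 1 := by
  have h := p.tsum_coe
  rw [tsum_fintype] at h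
  rw [← ENNReal.toReal_sum fun i _ => p.apply_ne_top i, h, ENNReal.toReal_one]

end pmf

section history

variable {X A : Type*}

theorem history_succ (ω : ℕ → Record X A) (n : ℕ) : history ω (n + 1) = ω n :: history ω n := by
  unfold history
  rw [List.ofFn_succ', List.concat_eq_append, List.reverse_append]
  simp

theorem length_history (ω : ℕ → Record X A) (n : ℕ) : (history ω n).length = n := by
  simp [history]

end history

/-! ### The law of the run and conditioning on the past -/

section run

variable {X A : Type*} [Fintype X] [Fintype A] (M : MDP X A) (alg : Algorithm X A)

/-- The conditional mean of a function of the record of the next round. -/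
def stepMean (h : List (Record X A)) (f : Record X A → ℝ) : ℝ :=
  ∑ x, (nextState M h x).toReal * ∑ a, (epochAfter M alg h).π x a *
    ∑ y, M.P x a y * ((1 - M.γ) * f ⟨x, a, y, true⟩ + M.γ * f ⟨x, a, y, false⟩)

theorem integral_nextRecord (h : List (Record X A)) (f : Record X A → ℝ) :
    ∫ z, f z ∂(nextRecord M alg h).toMeasure = stepMean M alg h f := by
  have := Fintype.ofFinite (Record X A)
  have hc : ∀ g : Bool → ℝ, ∑ b, (resetCoin M b).toReal * g b
      = (1 - M.γ) * g true + M.γ * g false := fun g => by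
    simp [resetCoin, M.γ_pos.le, M.γ_lt_one.le]
  rw [PMF.integral_eq_sum]
  simp only [smul_eq_mul, nextRecord, pmf_bind_mean, pmf_pure_mean, toPMF_toReal, hc]
  rfl

theorem stepMean_add (h : List (Record X A)) (f g : Record X A → ℝ) :
    stepMean M alg h (fun z => f z + g z) = stepMean M alg h f + stepMean M alg h g := by
  have := Fintype.ofFinite (Record X A)
  simp only [← integral_nextRecord, PMF.integral_eq_sum, smul_eq_mul, mul_add,
    Finset.sum_add_distrib]

theorem stepMean_const_mul (h : List (Record X A)) (c : ℝ) (f : Record X A → ℝ) :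
    stepMean M alg h (fun z => c * f z) = c * stepMean M alg h f := by
  simp only [← integral_nextRecord, integral_const_mul]

theorem stepMean_const (h : List (Record X A)) (c : ℝ) : stepMean M alg h (fun _ => c) = c := by
  rw [← integral_nextRecord]
  simp

theorem stepMean_reset (h : List (Record X A)) (c d : ℝ) :
    stepMean M alg h (fun z => if z.reset then c else d) = (1 - M.γ) * c + M.γ * d := by
  simp [stepMean, ← Finset.sum_mul, pmf_sum_toReal]

/-- The reset acts as the discount: the continuation `v` survives with probability `γ`, which yields
the right-hand side of a Bellman equation. -/
theorem stepMean_state_action (h : List (Record X A)) (g : X → A → ℝ) (v : X → ℝ) :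
    stepMean M alg h (fun z => g z.state z.action + if z.reset then 0 else v z.next)
      = ∑ x, (nextState M h x).toReal * ∑ a, (epochAfter M alg h).π x a *
        (g x a + M.γ * ∑ y, M.P x a y * v y) := by
  unfold stepMean
  refine Finset.sum_congr rfl fun x _ => congrArg _ <| Finset.sum_congr rfl fun a _ =>
    congrArg _ ?_
  have e : ∀ y, M.P x a y * ((1 - M.γ) * (g x a + 0) + M.γ * (g x a + v y))
      = M.P x a y * g x a + M.γ * (M.P x a y * v y) := fun y => by ring
  simp only [if_true, Bool.false_eq_true, if_false, e, Finset.sum_add_distrib, ← Finset.sum_mul,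
    ← Finset.mul_sum, simplex_sum, one_mul]

/-- The transition kernel of the process of records. -/
def recordKernel (n : ℕ) : Kernel ((i : Finset.Iic n) → Record X A) (Record X A) :=
  Kernel.ofFunOfCountable fun h : (i : Finset.Iic n) → Record X A =>
    (nextRecord M alg (List.ofFn fun i : Fin (n + 1) =>
      h ⟨i, Finset.mem_Iic.2 (Nat.lt_succ_iff.1 i.2)⟩).reverse).toMeasure

instance (n : ℕ) : IsMarkovKernel (recordKernel M alg n) :=
  ⟨fun _ => PMF.toMeasure.isProbabilityMeasure _⟩

theorem runLaw_eq : runLaw M alg = Kernel.trajMeasure (X := fun _ => Record X A)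
    (nextRecord M alg []).toMeasure (recordKernel M alg) := rfl

instance : IsProbabilityMeasure (runLaw M alg) := by
  rw [runLaw_eq]
  infer_instance

theorem measurable_history (F : List (Record X A) → ℝ) (n : ℕ) :
    Measurable fun ω : ℕ → Record X A => F (history ω n) := by
  have h : Measurable fun w : Fin n → Record X A => F (List.ofFn w).reverse :=
    measurable_of_countable _
  exact h.comp (measurable_pi_lambda (fun (ω : ℕ → Record X A) (i : Fin n) => ω i)
    fun i => measurable_pi_apply _)

theorem integrable_history (F : List (Record X A) → ℝ) (n : ℕ) :
    Integrable (fun ω => F (history ω n)) (runLaw M alg) := by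
  have h : Measurable fun (ω : ℕ → Record X A) (i : Fin n) => ω i :=
    measurable_pi_lambda _ fun i => measurable_pi_apply _
  have hi : Integrable (fun w : Fin n → Record X A => F (List.ofFn w).reverse)
    ((runLaw M alg).map fun ω i => ω i) := .of_finite
  exact hi.comp_measurable h

theorem map_runLaw_zero :
    (runLaw M alg).map (fun ω => ω 0) = (nextRecord M alg []).toMeasure := by
  have h : (fun ω : ℕ → Record X A => ω 0)
      = (MeasurableEquiv.piUnique fun _ : Finset.Iic 0 => Record X A)
        ∘ Preorder.frestrictLe 0 := rfl
  rw [h, ← Measure.map_map (MeasurableEquiv.measurable _) (by fun_prop), runLaw_eq,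
    Kernel.trajMeasure, Measure.map_comp _ _ (by fun_prop), Kernel.traj_map_frestrictLe,
    Kernel.partialTraj_self, Measure.id_comp,
    Measure.map_map (MeasurableEquiv.measurable _) (MeasurableEquiv.measurable _),
    MeasurableEquiv.self_comp_symm, Measure.map_id]

/-- Conditioning on the past. -/
theorem integral_step (F : List (Record X A) → Record X A → ℝ) (n : ℕ) :
    ∫ ω, F (history ω n) (ω n) ∂(runLaw M alg)
      = ∫ ω, stepMean M alg (history ω n) (F (history ω n)) ∂(runLaw M alg) := by
  cases n with
  | zero =>
    -- The first record has the initial law of the trajectory measure rather than one of its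
    -- kernels.
    have h0 : ∀ ω : ℕ → Record X A, history ω 0 = [] := fun ω => rfl
    simp only [h0, integral_const, probReal_univ, one_smul]
    rw [← integral_nextRecord, ← map_runLaw_zero, integral_map (measurable_pi_apply 0).aemeasurable
      (measurable_of_countable _).aestronglyMeasurable]
  | succ n =>
    let φ : ((i : Finset.Iic n) → Record X A) → List (Record X A) := fun h =>
      (List.ofFn fun i : Fin (n + 1) => h ⟨i, Finset.mem_Iic.2 (Nat.lt_succ_iff.1 i.2)⟩).reverse
    have hφ : ∀ ω : ℕ → Record X A, history ω (n + 1) = φ (Preorder.frestrictLe n ω) :=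
      fun ω => rfl
    have key := Kernel.map_frestrictLe_trajMeasure_compProd_eq_map_trajMeasure
      (X := fun _ => Record X A) (μ₀ := (nextRecord M alg []).toMeasure) (κ := recordKernel M alg) (a := n)
    rw [← runLaw_eq] at key
    have hm : Measurable fun ω : ℕ → Record X A => (Preorder.frestrictLe n ω, ω (n + 1)) := by
      fun_prop
    have h1 : ∫ ω, F (history ω (n + 1)) (ω (n + 1)) ∂(runLaw M alg)
        = ∫ p, F (φ p.1) p.2
          ∂((runLaw M alg).map fun ω => (Preorder.frestrictLe n ω, ω (n + 1))) := by
      rw [integral_map hm.aemeasurable (measurable_of_countable _).aestronglyMeasurable]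
      rfl
    rw [h1, ← key, Measure.integral_compProd .of_finite,
      integral_map (by fun_prop) (measurable_of_countable _).aestronglyMeasurable]
    refine integral_congr_ae (.of_forall fun ω => ?_)
    exact integral_nextRecord M alg (φ (Preorder.frestrictLe n ω)) _

theorem integral_history_succ (F : List (Record X A) → ℝ) (n : ℕ) :
    ∫ ω, F (history ω (n + 1)) ∂(runLaw M alg)
      = ∫ ω, stepMean M alg (history ω n) (fun z => F (z :: history ω n)) ∂(runLaw M alg) := by
  simp only [history_succ]
  exact integral_step M alg (fun h z => F (z :: h)) n

end run

theorem pmf_mean_abs_le {ι : Type*} [Fintype ι] (p : PMF ι) {f : ι → ℝ} {B : ℝ}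
    (h : ∀ i, |f i| ≤ B) : |∑ i, (p i).toReal * f i| ≤ B := by
  let q : stdSimplex ℝ ι :=
    ⟨fun i => (p i).toReal, fun i => ENNReal.toReal_nonneg, pmf_sum_toReal p⟩
  exact abs_le.2 ⟨le_simplex_mean q fun i => (abs_le.1 (h i)).1,
    simplex_mean_le q fun i => (abs_le.1 (h i)).2⟩

/-! ### Survival up to `T⁺` and the epoch count -/

section alive

variable {X A : Type*}

/-- The indicator that no round `t ≥ T` of the history ended with a reset, so that the next round
is not after `T⁺`. -/
def alive (T : ℕ) : List (Record X A) → ℝ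
  | [] => 1
  | z :: h => if z.reset then (if T ≤ h.length + 1 then 0 else alive T h) else alive T h

theorem alive_eq_zero_or_one (T : ℕ) (h : List (Record X A)) : alive T h = 0 ∨ alive T h = 1 := by
  induction h with
  | nil => exact Or.inr rfl
  | cons z h ih =>
    unfold alive
    split_ifs
    exacts [Or.inl rfl, ih, ih]

theorem alive_nonneg (T : ℕ) (h : List (Record X A)) : 0 ≤ alive T h := by
  rcases alive_eq_zero_or_one T h with e | e <;> simp [e]

theorem alive_of_length_lt {T : ℕ} {h : List (Record X A)} (hT : h.length < T) :
    alive T h = 1 := by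
  induction h with
  | nil => rfl
  | cons z h ih =>
    have h1 : h.length + 1 < T := hT
    simp [alive, h1.not_ge, ih (Nat.lt_of_succ_lt h1)]

theorem alive_history_eq_one_iff {T : ℕ} (ω : ℕ → Record X A) (n : ℕ) :
    alive T (history ω n) = 1 ↔ ∀ m < n, T ≤ m + 1 → (ω m).reset = false := by
  induction n with
  | zero => simp [history, alive]
  | succ n ih =>
    rw [history_succ, alive, length_history, Nat.forall_lt_succ_right, ← ih]
    cases (ω n).reset <;> by_cases hT : T ≤ n + 1 <;> simp [hT]

/-- The number of epochs started in a history, including the one of the next round. -/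
def epochCount : List (Record X A) → ℝ
  | [] => 1
  | z :: h => if z.reset then epochCount h + 1 else epochCount h

end alive

/-! ### The compensated martingale and the telescoping over epochs -/

section potential

variable {X A : Type*} [Fintype X] [Fintype A] (M : MDP X A) (alg : Algorithm X A)
  (πstar : Policy X A)

/-- Twice the bonus minus the regret of the epoch. -/
def epochReward (e : Epoch X A) (x : X) (a : A) : ℝ :=
  2 * e.CB x a - (M.ret πstar - M.ret e.π)

/-- The mean of the sum of the epoch rewards over the rest of the current epoch. -/
def epochValue (h : List (Record X A)) : ℝ :=
  ∑ x, (nextState M h x).toReal *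
    M.value (epochAfter M alg h).π (epochReward M πstar (epochAfter M alg h)) x

/-- The sum of the values of the epochs that start at or before round `T`. -/
def startValues (T : ℕ) : List (Record X A) → ℝ
  | [] => epochValue M alg πstar []
  | z :: h =>
    -- The record `z` belongs to round `h.length + 1`, so the new epoch starts with round `h.length
    -- + 2 ≤ T`.
    if z.reset ∧ h.length + 1 < T then startValues T h + epochValue M alg πstar (z :: h)
    else startValues T h

/-- The sum of `f` over the rounds of the history up to `T⁺`. -/
def accum (f : Epoch X A → X → A → ℝ) (T : ℕ) : List (Record X A) → ℝ
  | [] => 0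
  | z :: h => accum f T h + alive T h * f (epochAfter M alg h) z.state z.action

theorem accum_history (f : Epoch X A → X → A → ℝ) (T : ℕ) (ω : ℕ → Record X A) (n : ℕ) :
    accum M alg f T (history ω n) = ∑ m ∈ Finset.range n,
      alive T (history ω m) * f (epochOf M alg ω m) (ω m).state (ω m).action := by
  induction n with
  | zero => rfl
  | succ n ih => rw [history_succ, accum, ih, Finset.sum_range_succ]; rfl

theorem stepMean_alive (T : ℕ) (h : List (Record X A)) (hT : T ≤ h.length + 1) :
    stepMean M alg h (fun z => alive T (z :: h)) = M.γ * alive T h := by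
  simp only [alive, if_pos hT, stepMean_reset, mul_zero, zero_add]

/-- Only resets that end round `T` or a later one matter, and each such round survives with
probability `γ`; hence the offset `T - 1`. -/
theorem integral_alive {T : ℕ} (hT : 1 ≤ T) (n : ℕ) :
    ∫ ω, alive T (history ω (T - 1 + n)) ∂(runLaw M alg) = M.γ ^ n := by
  induction n with
  | zero =>
    have h : ∀ ω : ℕ → Record X A, alive T (history ω (T - 1 + 0)) = 1 := fun ω =>
      alive_of_length_lt (by rw [length_history]; omega)
    simp only [h]
    simp
  | succ n ih =>
    rw [← add_assoc, integral_history_succ M alg (alive T)]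
    have h : ∀ ω : ℕ → Record X A, stepMean M alg (history ω (T - 1 + n))
        (fun z => alive T (z :: history ω (T - 1 + n)))
        = M.γ * alive T (history ω (T - 1 + n)) := fun ω =>
      stepMean_alive M alg T _ (by rw [length_history]; omega)
    simp only [h, integral_const_mul, ih, pow_succ']

theorem integral_epochCount (n : ℕ) :
    ∫ ω, epochCount (history ω n) ∂(runLaw M alg) = 1 + n * (1 - M.γ) := by
  induction n with
  | zero => simp [history, epochCount]
  | succ n ih =>
    have h : ∀ ω : ℕ → Record X A, stepMean M alg (history ω n)
        (fun z => epochCount (z :: history ω n)) = epochCount (history ω n) + (1 - M.γ) :=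
      fun ω => by
        simp only [epochCount, stepMean_reset]
        ring
    rw [integral_history_succ M alg epochCount]
    simp only [h]
    rw [integral_add (integrable_history M alg _ n) (integrable_const _), ih]
    simp only [integral_const, probReal_univ, one_smul]
    push_cast
    ring

theorem epochValue_cons {z : Record X A} (hz : z.reset = false) (h : List (Record X A)) :
    epochValue M alg πstar (z :: h) = M.value (epochAfter M alg h).π
      (epochReward M πstar (epochAfter M alg h)) z.next := by
  simp only [epochValue, epochAfter_cons alg hz, nextState, hz, Bool.false_eq_true, if_false,
    pmf_pure_mean]

/-- The compensated sum of the epoch rewards is a martingale. -/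
theorem stepMean_compensated (T : ℕ) (h : List (Record X A)) :
    stepMean M alg h (fun z => accum M alg (epochReward M πstar) T (z :: h)
      + alive T (z :: h) * epochValue M alg πstar (z :: h) - startValues M alg πstar T (z :: h))
      = accum M alg (epochReward M πstar) T h
        + alive T h * epochValue M alg πstar h - startValues M alg πstar T h := by
  -- Without a reset the value moves to `z.next`. At a reset before round `T` the new epoch's value
  -- enters twice and cancels; from round `T` on, `alive` vanishes. The mean of the bracket is then
  -- `epochValue` by the Bellman equation.
  have e : ∀ z : Record X A, accum M alg (epochReward M πstar) T (z :: h)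
      + alive T (z :: h) * epochValue M alg πstar (z :: h) - startValues M alg πstar T (z :: h)
      = (accum M alg (epochReward M πstar) T h - startValues M alg πstar T h)
        + alive T h * (epochReward M πstar (epochAfter M alg h) z.state z.action
          + if z.reset then 0 else M.value (epochAfter M alg h).π
            (epochReward M πstar (epochAfter M alg h)) z.next) := fun z => by
    cases hz : z.reset
    · rw [epochValue_cons M alg πstar hz]
      simp [accum, alive, startValues, hz]
      ring
    · by_cases hT : T ≤ h.length + 1
      · simp [accum, alive, startValues, hz, hT, hT.not_gt]
        ring
      · have h1 : alive T h = 1 := alive_of_length_lt (by omega)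
        simp [accum, alive, startValues, hz, hT, not_le.1 hT, h1]
        ring
  simp only [e]
  rw [stepMean_add, stepMean_const, stepMean_const_mul, stepMean_state_action]
  simp only [← MDP.value_eq, epochValue]
  ring

theorem integral_compensated (T n : ℕ) :
    ∫ ω, (accum M alg (epochReward M πstar) T (history ω n)
      + alive T (history ω n) * epochValue M alg πstar (history ω n)
      - startValues M alg πstar T (history ω n)) ∂(runLaw M alg) = 0 := by
  induction n with
  | zero => simp [history, accum, alive, startValues]
  | succ n ih =>
    rw [integral_history_succ M alg fun h => accum M alg (epochReward M πstar) T h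
      + alive T h * epochValue M alg πstar h - startValues M alg πstar T h]
    simp only [stepMean_compensated, ih]

theorem startValues_history (T n : ℕ) (ω : ℕ → Record X A) :
    startValues M alg πstar T (history ω (T - 1 + n))
      = startValues M alg πstar T (history ω (T - 1)) := by
  induction n with
  | zero => rfl
  | succ n ih =>
    rw [← add_assoc, history_succ, startValues, length_history,
      if_neg (by rintro ⟨-, h⟩; omega), ih]

variable {M πstar}

/-- From `ν₀`, the epoch value is `H` times the occupancy mean of the epoch reward, to which
`regret_le` applies. -/
theorem epochValue_start {h : List (Record X A)} (hs : nextState M h = toPMF M.ν₀)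
    (hr : (epochAfter M alg h).Regular M πstar) (hv : (epochAfter M alg h).Valid M) :
    -(M.H * (epochAfter M alg h).gap M πstar) ≤ epochValue M alg πstar h := by
  simp only [epochValue, hs, toPMF_toReal, MDP.initial_value]
  rw [← mul_neg]
  refine mul_le_mul_of_nonneg_left ?_ M.H_pos.le
  have h1 := hr.regret_le hv
  set e := epochAfter M alg h
  have e1 : ∀ x, M.stateOcc e.π x * ∑ a, e.π x a * epochReward M πstar e x a
      = 2 * (M.stateOcc e.π x * ∑ a, e.π x a * e.CB x a)
        - M.stateOcc e.π x * (M.ret πstar - M.ret e.π) := fun x => by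
    have e2 : ∀ a, e.π x a * epochReward M πstar e x a
        = 2 * (e.π x a * e.CB x a) - e.π x a * (M.ret πstar - M.ret e.π) := fun a => by
      rw [epochReward]; ring
    simp only [e2, Finset.sum_sub_distrib, ← Finset.mul_sum, ← Finset.sum_mul, simplex_sum]
    ring
  simp only [e1, Finset.sum_sub_distrib, ← Finset.mul_sum, ← Finset.sum_mul, M.stateOcc_sum]
  linarith

/-- The telescoping bound on the values of the epochs. -/
theorem le_startValues (hη : 0 < alg.η) (hV₀ : ∀ x, alg.V₀ x = 0)
    (hπ : ∀ x a, 0 < M.occ πstar x a → 0 < alg.π₀ x a) {T : ℕ} {ω : ℕ → Record X A}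
    (hvalid : ∀ n < T, (epochOf M alg ω n).Valid M) {n : ℕ} (hn : n < T) :
    -(M.H * (1 / alg.η * M.condRelEntropy πstar alg.π₀ + M.H
        + epochCount (history ω n) * (M.H ^ 3 / 4 * alg.η)))
      ≤ startValues M alg πstar T (history ω n) := by
  have hr := regular_epochAfter (M := M) (πstar := πstar) alg hη hV₀ hπ
  -- The induction keeps the potential with which the next epoch would begin; it is discarded only
  -- at the end, through its lower bound `-H`.
  suffices h : -(M.H * (1 / alg.η * M.condRelEntropy πstar alg.π₀
      - potential M πstar alg.η (softPolicy alg.η (epochOf M alg ω n).π (epochOf M alg ω n).Qnext)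
        (softValue alg.η (epochOf M alg ω n).π (epochOf M alg ω n).Qnext)
      + epochCount (history ω n) * (M.H ^ 3 / 4 * alg.η)))
      ≤ startValues M alg πstar T (history ω n) by
    refine le_trans (neg_le_neg (mul_le_mul_of_nonneg_left ?_ M.H_pos.le)) h
    have hs := regular_startEpoch alg hη [] (hr (history ω n)).Qnext_mem (hr (history ω n)).support
    have h1 := neg_H_le_potential hη hs.support hs.V_mem
    simp only [startEpoch] at h1
    unfold epochOf
    linarith
  induction n with
  | zero =>
    have h1 := epochValue_start alg (h := []) rfl (hr []) (hvalid 0 hn)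
    have h2 := (hr []).gap_le hη
    have h3 : potential M πstar alg.η (epochAfter M alg []).π (epochAfter M alg []).V
        = 1 / alg.η * M.condRelEntropy πstar alg.π₀ := by
      simp only [potential, epochAfter_nil_V alg hV₀, epochAfter_nil_π alg hV₀, mul_zero,
        Finset.sum_const_zero, sub_zero, add_zero]
    rw [h3] at h2
    refine le_trans (neg_le_neg (mul_le_mul_of_nonneg_left ?_ M.H_pos.le)) h1
    refine h2.trans_eq ?_
    simp [history, epochCount, epochOf]
  | succ n ih =>
    have ih := ih (Nat.lt_of_succ_lt hn)
    unfold epochOf at ih ⊢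
    cases hz : (ω n).reset
    · rw [history_succ, epochAfter_cons alg hz]
      simpa [startValues, epochCount, hz] using ih
    · have hv := hvalid (n + 1) hn
      have hr' := hr (history ω (n + 1))
      unfold epochOf at hv
      rw [history_succ] at hv hr' ⊢
      have h1 := epochValue_start alg (h := ω n :: history ω n) (by simp [nextState, hz]) hr' hv
      have h2 := hr'.gap_le hη
      have h3 : potential M πstar alg.η (epochAfter M alg (ω n :: history ω n)).π
          (epochAfter M alg (ω n :: history ω n)).V
          = potential M πstar alg.η
            (softPolicy alg.η (epochAfter M alg (history ω n)).π
              (epochAfter M alg (history ω n)).Qnext)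
            (softValue alg.η (epochAfter M alg (history ω n)).π
              (epochAfter M alg (history ω n)).Qnext) := by
        rw [epochAfter_cons_reset alg hz]
        rfl
      rw [h3] at h2
      have h4 := mul_le_mul_of_nonneg_left h2 M.H_pos.le
      have h5 : startValues M alg πstar T (ω n :: history ω n)
          = startValues M alg πstar T (history ω n)
            + epochValue M alg πstar (ω n :: history ω n) := by
        simp [startValues, hz, length_history, hn]
      have h6 : epochCount (ω n :: history ω n) = epochCount (history ω n) + 1 := by
        simp [epochCount, hz]
      rw [h5, h6]
      linarith

end potential

/-! ### The stopping round `T⁺` -/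

section lastRound

variable {X A : Type*} {T : ℕ} {ω : ℕ → Record X A} {n : ℕ}

theorem alive_of_lt_lastRound (hn : n < lastRound T ω) : alive T (history ω n) = 1 := by
  rw [alive_history_eq_one_iff]
  intro m hm hT
  by_contra hr
  have : lastRound T ω ≤ m + 1 := Nat.sInf_le ⟨hT, m, rfl, by simpa using hr⟩
  omega

/-- The witness `k` guarantees that a reset occurs at or after round `T`; otherwise `lastRound`
would be the infimum of the empty set, which is `0`. -/
theorem lt_lastRound_of_alive {k : ℕ} (hk : alive T (history ω k) ≠ 1)
    (hn : alive T (history ω n) = 1) : n < lastRound T ω := by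
  rw [Ne, alive_history_eq_one_iff] at hk
  push Not at hk
  obtain ⟨m, -, hT, hr⟩ := hk
  have hne : {t | T ≤ t ∧ ∃ n, t = n + 1 ∧ (ω n).reset = true}.Nonempty :=
    ⟨m + 1, hT, m, rfl, by simpa using hr⟩
  obtain ⟨h1, j, hj, hjr⟩ := Nat.sInf_mem hne
  by_contra! hc
  have hj' : lastRound T ω = j + 1 := hj
  have := (alive_history_eq_one_iff ω n).1 hn j (by omega) (hj ▸ h1)
  simp [hjr] at this

/-- The number of rounds up to `T⁺`. -/
def aliveTime (T : ℕ) (ω : ℕ → Record X A) : ENNReal :=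
  ∑' n, ENNReal.ofReal (alive T (history ω n))

theorem lastRound_le_aliveTime (hω : aliveTime T ω < ⊤) :
    (lastRound T ω : ℝ) ≤ (aliveTime T ω).toReal := by
  have h : ((lastRound T ω : ℕ) : ENNReal) ≤ aliveTime T ω := by
    refine le_trans (le_of_eq ?_) (ENNReal.sum_le_tsum (Finset.range (lastRound T ω)))
    rw [Finset.sum_congr rfl fun n hn => by
      rw [alive_of_lt_lastRound (Finset.mem_range.1 hn), ENNReal.ofReal_one]]
    simp
  simpa using ENNReal.toReal_mono hω.ne h

end lastRound

/-! ### Integrability and the regret bound -/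

section run

variable {X A : Type*} [Fintype X] [Fintype A] (M : MDP X A) (alg : Algorithm X A) {T : ℕ}

/-- No reset has ended a round from `T` on, so the current epoch is the one of round `T`. This
extends validity and bonus bounds to all rounds up to `T⁺`. -/
theorem exists_epoch_eq_of_alive (hT : 1 ≤ T) (ω : ℕ → Record X A) (n : ℕ)
    (hn : alive T (history ω n) = 1) : ∃ m < T, epochOf M alg ω n = epochOf M alg ω m := by
  rcases lt_or_ge n T with h | h
  · exact ⟨n, h, rfl⟩
  induction n with
  | zero => omega
  | succ n ih =>
    have hz := (alive_history_eq_one_iff ω (n + 1)).1 hn n n.lt_succ_self h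
    have hn' : alive T (history ω n) = 1 := (alive_history_eq_one_iff ω n).2 fun m hm =>
      (alive_history_eq_one_iff ω (n + 1)).1 hn m (Nat.lt_succ_of_lt hm)
    have e : epochOf M alg ω (n + 1) = epochOf M alg ω n := by
      unfold epochOf
      rw [history_succ, epochAfter_cons alg hz]
    rw [e]
    rcases lt_or_ge n T with h' | h'
    · exact ⟨n, h', rfl⟩
    · exact ih hn' h'

/-- Arbitrary bonuses are bounded here because only the finitely many histories shorter than `T`
matter. -/
theorem exists_bonus_bound (hT : 1 ≤ T) : ∃ B, 0 ≤ B ∧ ∀ (ω : ℕ → Record X A) n x a,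
    alive T (history ω n) = 1 → |(epochOf M alg ω n).CB x a| ≤ B := by
  have hfin : ((fun p : List (Record X A) × X × A => |(epochAfter M alg p.1).CB p.2.1 p.2.2|) ''
      ({h | h.length < T} ×ˢ Set.univ)).Finite :=
    ((List.finite_length_lt _ T).prod Set.finite_univ).image _
  obtain ⟨B, hB⟩ := hfin.bddAbove
  refine ⟨max B 0, le_max_right _ _, fun ω n x a hn => le_max_of_le_left ?_⟩
  obtain ⟨m, hm, e⟩ := exists_epoch_eq_of_alive M alg hT ω n hn
  rw [e]
  exact hB ⟨(history ω m, x, a), ⟨by simpa [length_history] using hm, trivial⟩, rfl⟩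

theorem measurable_aliveTime : Measurable (aliveTime T : (ℕ → Record X A) → ENNReal) :=
  Measurable.tsum fun n => (measurable_history (alive T) n).ennreal_ofReal

theorem lintegral_aliveTime_ne_top (hT : 1 ≤ T) :
    ∫⁻ ω, aliveTime T ω ∂(runLaw M alg) ≠ ⊤ := by
  unfold aliveTime
  rw [lintegral_tsum fun n => (measurable_history (alive T) n).ennreal_ofReal.aemeasurable]
  have h : ∀ n, ∫⁻ ω, ENNReal.ofReal (alive T (history ω n)) ∂(runLaw M alg)
      = ENNReal.ofReal (∫ ω, alive T (history ω n) ∂(runLaw M alg)) := fun n =>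
    (ofReal_integral_eq_lintegral_ofReal (integrable_history M alg (alive T) n)
      (.of_forall fun ω => alive_nonneg T _)).symm
  simp only [h]
  refine Summable.tsum_ofReal_ne_top ?_
  rw [← summable_nat_add_iff (T - 1)]
  refine (summable_geometric_of_lt_one M.γ_pos.le M.γ_lt_one).congr fun n => ?_
  rw [add_comm, integral_alive M alg hT]

theorem ae_exists_not_alive (hT : 1 ≤ T) :
    ∀ᵐ ω ∂(runLaw M alg), aliveTime T ω < ⊤ ∧ ∃ k, alive T (history ω k) ≠ 1 := by
  filter_upwards [ae_lt_top measurable_aliveTime (lintegral_aliveTime_ne_top M alg hT)] with ω hω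
  refine ⟨hω, ?_⟩
  by_contra! hc
  simp [aliveTime, hc] at hω

theorem accum_bonus_eq_bonusSum {ω : ℕ → Record X A} {k : ℕ} (hk : alive T (history ω k) ≠ 1)
    {N : ℕ} (hN : lastRound T ω ≤ N) :
    accum M alg Epoch.CB T (history ω N) = bonusSum M alg T ω := by
  rw [accum_history, bonusSum, ← Finset.sum_subset (Finset.range_mono hN)]
  · refine Finset.sum_congr rfl fun n hn => ?_
    rw [alive_of_lt_lastRound (Finset.mem_range.1 hn), one_mul]
  · intro n _ hn
    rcases alive_eq_zero_or_one T (history ω n) with h | h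
    · rw [h, zero_mul]
    · exact absurd (Finset.mem_range.2 (lt_lastRound_of_alive hk h)) hn

/-- The sum is dominated by a constant times the integrable `aliveTime`, and is measurable as an
almost sure limit of functions of finite histories. -/
theorem integrable_bonusSum (hT : 1 ≤ T) : Integrable (bonusSum M alg T) (runLaw M alg) := by
  obtain ⟨B, hB0, hB⟩ := exists_bonus_bound M alg hT
  have hint : Integrable (fun ω => B * (aliveTime T ω).toReal) (runLaw M alg) :=
    (integrable_toReal_of_lintegral_ne_top measurable_aliveTime.aemeasurable
      (lintegral_aliveTime_ne_top M alg hT)).const_mul B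
  refine hint.mono' ?_ ?_
  · refine aestronglyMeasurable_of_tendsto_ae Filter.atTop
      (f := fun N ω => accum M alg Epoch.CB T (history ω N))
      (fun N => (measurable_history _ N).aestronglyMeasurable) ?_
    filter_upwards [ae_exists_not_alive M alg hT] with ω hω
    obtain ⟨-, k, hk⟩ := hω
    refine tendsto_const_nhds.congr' ?_
    filter_upwards [Filter.eventually_ge_atTop (lastRound T ω)] with N hN
    exact (accum_bonus_eq_bonusSum M alg hk hN).symm
  · filter_upwards [ae_exists_not_alive M alg hT] with ω hω
    have h : ‖bonusSum M alg T ω‖ ≤ ∑ n ∈ Finset.range (lastRound T ω), B :=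
      norm_sum_le_of_le _ fun n hn => hB ω n _ _ (alive_of_lt_lastRound (Finset.mem_range.1 hn))
    rw [Finset.sum_const, Finset.card_range, nsmul_eq_mul, mul_comm] at h
    exact h.trans (mul_le_mul_of_nonneg_left (lastRound_le_aliveTime hω.1) hB0)

theorem accum_bonus_le_bonusSum (hT : 1 ≤ T) {ω : ℕ → Record X A}
    (hvalid : ∀ n < T, (epochOf M alg ω n).Valid M) {k : ℕ} (hk : alive T (history ω k) ≠ 1)
    (N : ℕ) : accum M alg Epoch.CB T (history ω N) ≤ bonusSum M alg T ω := by
  rw [← accum_bonus_eq_bonusSum M alg hk (le_max_right N _), accum_history, accum_history]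
  refine Finset.sum_le_sum_of_subset_of_nonneg (Finset.range_mono (le_max_left _ _))
    fun n _ _ => ?_
  rcases alive_eq_zero_or_one T (history ω n) with h | h
  · rw [h, zero_mul]
  · obtain ⟨m, hm, e⟩ := exists_epoch_eq_of_alive M alg hT ω n h
    rw [h, one_mul, e]
    exact (hvalid m hm).CB_nonneg _ _

theorem integrable_regretSum (πstar : Policy X A) (T : ℕ) :
    Integrable (regretSum M alg πstar T) (runLaw M alg) :=
  integrable_finsetSum _ fun n _ =>
    integrable_history M alg (fun h => M.ret πstar - M.ret (epochAfter M alg h).π) n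

variable {πstar : Policy X A}

theorem regretSum_le (T : ℕ) (ω : ℕ → Record X A) : regretSum M alg πstar T ω ≤ T := by
  have h : regretSum M alg πstar T ω ≤ ∑ n ∈ Finset.range T, (1 : ℝ) :=
    Finset.sum_le_sum fun n _ => by
      linarith [M.ret_le_one πstar, M.ret_nonneg (epochOf M alg ω n).π]
  simpa using h

/-- Optimality of `πstar` makes the regrets between `T` and `T⁺` nonnegative, so adding them only
weakens the bound. -/
theorem regretSum_add_accum_le (hstar : M.IsOptimal πstar) {N : ℕ} (hN : T ≤ N)
    (ω : ℕ → Record X A) :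
    regretSum M alg πstar T ω + accum M alg (epochReward M πstar) T (history ω N)
      ≤ 2 * accum M alg Epoch.CB T (history ω N) := by
  have h : regretSum M alg πstar T ω ≤ ∑ n ∈ Finset.range N,
      alive T (history ω n) * (M.ret πstar - M.ret (epochOf M alg ω n).π) := by
    refine le_trans (Finset.sum_le_sum fun n hn => le_of_eq ?_)
      (Finset.sum_le_sum_of_subset_of_nonneg (Finset.range_mono hN) fun n _ _ =>
        mul_nonneg (alive_nonneg _ _) (sub_nonneg.2 (hstar _)))
    rw [alive_of_length_lt (by rw [length_history]; exact Finset.mem_range.1 hn), one_mul]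
  refine (add_le_add_left h _).trans_eq ?_
  rw [accum_history, accum_history, ← Finset.sum_add_distrib, Finset.mul_sum]
  refine Finset.sum_congr rfl fun n _ => ?_
  rw [epochReward]
  ring

theorem abs_epochValue_le {B : ℝ} {ω : ℕ → Record X A} {n : ℕ}
    (hB : ∀ x a, |(epochOf M alg ω n).CB x a| ≤ B) :
    |epochValue M alg πstar (history ω n)| ≤ (2 * B + 1) * M.H := by
  have h1 := M.ret_nonneg πstar
  have h2 := M.ret_le_one πstar
  have h3 := M.ret_nonneg (epochOf M alg ω n).π
  have h4 := M.ret_le_one (epochOf M alg ω n).π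
  refine pmf_mean_abs_le _ fun x => abs_le.2 ⟨?_, ?_⟩
  · rw [← neg_mul]
    refine M.le_value _ (fun x a => ?_) x
    have := (abs_le.1 (hB x a)).1
    change _ ≤ 2 * (epochOf M alg ω n).CB x a - (_ - M.ret (epochOf M alg ω n).π)
    linarith
  · refine M.value_le _ (fun x a => ?_) x
    have := (abs_le.1 (hB x a)).2
    change 2 * (epochOf M alg ω n).CB x a - (_ - M.ret (epochOf M alg ω n).π) ≤ _
    linarith

/-- The regret bound for a general learning rate. -/
theorem integral_regretSum_le (hT : 1 ≤ T) (hη : 0 < alg.η) (hV₀ : ∀ x, alg.V₀ x = 0)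
    (hvalid : ∀ᵐ ω ∂(runLaw M alg), ∀ n < T, (epochOf M alg ω n).Valid M)
    (hstar : M.IsOptimal πstar) (hπ : ∀ x a, 0 < M.occ πstar x a → 0 < alg.π₀ x a) :
    ∫ ω, regretSum M alg πstar T ω ∂(runLaw M alg)
      ≤ 2 * ∫ ω, bonusSum M alg T ω ∂(runLaw M alg)
        + M.H * (1 / alg.η * M.condRelEntropy πstar alg.π₀ + M.H
          + (1 + (T - 1) * (1 - M.γ)) * (M.H ^ 3 / 4 * alg.η)) := by
  obtain ⟨B, hB0, hB⟩ := exists_bonus_bound M alg hT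
  set μ := runLaw M alg
  set c := M.H ^ 3 / 4 * alg.η
  set b := 1 / alg.η * M.condRelEntropy πstar alg.π₀ + M.H
  -- The martingale is evaluated `k + 1` rounds after `T - 1`. The unfinished epoch leaves an error
  -- of order `γ^(k+1)`, which vanishes in the limit.
  have hbound : ∀ k : ℕ, ∫ ω, regretSum M alg πstar T ω ∂μ
      ≤ 2 * ∫ ω, bonusSum M alg T ω ∂μ + M.H * (b + (1 + (T - 1) * (1 - M.γ)) * c)
        + (2 * B + 1) * M.H * M.γ ^ (k + 1) := fun k => by
    have i1 : Integrable (fun ω => accum M alg (epochReward M πstar) T (history ω (T - 1 + (k + 1)))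
        + alive T (history ω (T - 1 + (k + 1)))
          * epochValue M alg πstar (history ω (T - 1 + (k + 1)))
        - startValues M alg πstar T (history ω (T - 1 + (k + 1)))) μ :=
      integrable_history M alg (fun h => accum M alg (epochReward M πstar) T h
        + alive T h * epochValue M alg πstar h - startValues M alg πstar T h) _
    have i2 : Integrable (fun ω => alive T (history ω (T - 1 + (k + 1)))) μ :=
      integrable_history M alg (alive T) _
    have i3 : Integrable (fun ω : ℕ → Record X A => epochCount (history ω (T - 1))) μ :=
      integrable_history M alg epochCount _
    have i4 := integrable_bonusSum M alg hT
    have i5 := integrable_regretSum M alg πstar T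
    have key : ∫ ω, (regretSum M alg πstar T ω
        + (accum M alg (epochReward M πstar) T (history ω (T - 1 + (k + 1)))
        + alive T (history ω (T - 1 + (k + 1)))
          * epochValue M alg πstar (history ω (T - 1 + (k + 1)))
        - startValues M alg πstar T (history ω (T - 1 + (k + 1))))) ∂μ
        ≤ ∫ ω, (2 * bonusSum M alg T ω + (M.H * b + M.H * c * epochCount (history ω (T - 1)))
          + (2 * B + 1) * M.H * alive T (history ω (T - 1 + (k + 1)))) ∂μ := by
      refine integral_mono_ae (i5.add i1) (((i4.const_mul 2).add
        ((integrable_const _).add (i3.const_mul _))).add (i2.const_mul _)) ?_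
      filter_upwards [hvalid, ae_exists_not_alive M alg hT] with ω hv hω
      obtain ⟨-, j, hj⟩ := hω
      have h1 := regretSum_add_accum_le M alg hstar (T := T) (N := T - 1 + (k + 1)) (by omega) ω
      have h2 := accum_bonus_le_bonusSum M alg hT hv hj (T - 1 + (k + 1))
      have h3 := le_startValues alg hη hV₀ hπ hv (n := T - 1) (by omega)
      rw [← startValues_history M alg πstar T (k + 1)] at h3
      change -(M.H * (b + epochCount (history ω (T - 1)) * c)) ≤ _ at h3
      have h4 : alive T (history ω (T - 1 + (k + 1)))
          * epochValue M alg πstar (history ω (T - 1 + (k + 1)))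
          ≤ (2 * B + 1) * M.H * alive T (history ω (T - 1 + (k + 1))) := by
        rcases alive_eq_zero_or_one T (history ω (T - 1 + (k + 1))) with h | h
        · simp [h]
        · rw [h, one_mul, mul_one]
          exact (abs_le.1 (abs_epochValue_le M alg fun x a => hB ω _ x a h)).2
      linarith
    have hcT : ((T - 1 : ℕ) : ℝ) = T - 1 := by rw [Nat.cast_sub hT, Nat.cast_one]
    rw [integral_add i5 i1, integral_compensated, integral_add, integral_add, integral_add,
      integral_const_mul, integral_const_mul, integral_const_mul, integral_const_mul,
      integral_alive M alg hT, integral_epochCount, integral_const, probReal_univ, one_smul,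
      hcT] at key
    · linarith
    · exact integrable_const _
    · exact i3.const_mul _
    · exact i4.const_mul 2
    · exact (integrable_const _).add (i3.const_mul _)
    · exact (i4.const_mul 2).add ((integrable_const _).add (i3.const_mul _))
    · exact i2.const_mul _
  refine ge_of_tendsto' (x := Filter.atTop) ?_ hbound
  have := ((tendsto_pow_atTop_nhds_zero_of_lt_one M.γ_pos.le M.γ_lt_one).comp
    (Filter.tendsto_add_atTop_nat 1)).const_mul ((2 * B + 1) * M.H)
  simpa using this.const_add (2 * ∫ ω, bonusSum M alg T ω ∂μ
    + M.H * (b + (1 + (T - 1) * (1 - M.γ)) * c))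

theorem integral_bonusSum_nonneg (hT : 1 ≤ T)
    (hvalid : ∀ᵐ ω ∂(runLaw M alg), ∀ n < T, (epochOf M alg ω n).Valid M) :
    0 ≤ ∫ ω, bonusSum M alg T ω ∂(runLaw M alg) := by
  refine integral_nonneg_of_ae ?_
  filter_upwards [hvalid, ae_exists_not_alive M alg hT] with ω hv hω
  obtain ⟨-, j, hj⟩ := hω
  exact accum_bonus_le_bonusSum M alg hT hv hj 0

/-- The regret bound for the tuned learning rate. -/
theorem integral_regretSum_le_of_tuned (hT : 1 ≤ T) (hη : 0 < alg.η) {L : ℝ}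
    (hL : L = alg.η ^ 2 * M.H ^ 2 * T / 2) (hV₀ : ∀ x, alg.V₀ x = 0)
    (hvalid : ∀ᵐ ω ∂(runLaw M alg), ∀ n < T, (epochOf M alg ω n).Valid M)
    (hstar : M.IsOptimal πstar) (hπ : ∀ x a, 0 < M.occ πstar x a → 0 < alg.π₀ x a) :
    ∫ ω, regretSum M alg πstar T ω ∂(runLaw M alg)
      ≤ 2 * ∫ ω, bonusSum M alg T ω ∂(runLaw M alg)
        + M.H / alg.η * (M.condRelEntropy πstar alg.π₀ + L) + 2 * M.H ^ 2 := by
  have hH := M.one_le_H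
  have hKL := M.condRelEntropy_nonneg hπ
  have hηL : M.H / alg.η * L = alg.η * M.H ^ 3 * T / 2 := by
    rw [hL]; field_simp
  have hT0 : (0 : ℝ) ≤ T := Nat.cast_nonneg T
  have h1 : 0 ≤ M.H / alg.η * M.condRelEntropy πstar alg.π₀ :=
    mul_nonneg (div_nonneg M.H_pos.le hη.le) hKL
  rw [mul_add, hηL]
  -- A horizon below `H - 1` is covered by regret at most `T` and the term `2H²`. Otherwise `H + T -
  -- 1 ≤ 2T`, which is where the factor two in the tuning comes from.
  rcases lt_or_ge (T : ℝ) (M.H - 1) with h | h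
  · have h2 := integral_bonusSum_nonneg M alg hT hvalid
    have h3 : ∫ ω, regretSum M alg πstar T ω ∂(runLaw M alg) ≤ T := by
      refine (integral_mono (integrable_regretSum M alg πstar T) (integrable_const (T : ℝ))
        (regretSum_le M alg T)).trans_eq ?_
      simp
    have h4 : 0 ≤ alg.η * M.H ^ 3 * T / 2 := by
      have := M.H_pos
      positivity
    nlinarith
  · refine (integral_regretSum_le M alg hT hη hV₀ hvalid hstar hπ).trans ?_
    have h2 : M.H * ((1 + (T - 1) * (1 - M.γ)) * (M.H ^ 3 / 4 * alg.η))
        = (M.H + T - 1) * (M.H ^ 3 / 4 * alg.η) := by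
      linear_combination ((T - 1) * (M.H ^ 3 / 4 * alg.η)) * M.one_sub_γ_mul_H
    have h3 : (M.H + T - 1) * (M.H ^ 3 / 4 * alg.η) ≤ (2 * T) * (M.H ^ 3 / 4 * alg.η) := by
      refine mul_le_mul_of_nonneg_right (by linarith) ?_
      have := M.H_pos
      positivity
    have h4 : M.H * (1 / alg.η * M.condRelEntropy πstar alg.π₀)
        = M.H / alg.η * M.condRelEntropy πstar alg.π₀ := by ring
    nlinarith [sq_nonneg M.H]

end run

end

end RaviUCB

theorem mainTheorem3 {X A : Type*} [Fintype X] [Fintype A]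
    (M : RaviUCB.MDP X A) (T : ℕ) (hT : 1 ≤ T) (hA : 2 ≤ Fintype.card A)
    (alg : RaviUCB.Algorithm X A)
    (hη : alg.η = Real.sqrt (2 * Real.log (Fintype.card A) / (M.H ^ 2 * T)))
    (hV₀ : ∀ x, alg.V₀ x = 0)
    (hvalid : ∀ᵐ ω ∂(RaviUCB.runLaw M alg), ∀ n < T, (RaviUCB.epochOf M alg ω n).Valid M)
    (πstar : RaviUCB.Policy X A) (hstar : M.IsOptimal πstar) :
    MeasureTheory.Integrable (RaviUCB.regretSum M alg πstar T) (RaviUCB.runLaw M alg) ∧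
    MeasureTheory.Integrable (RaviUCB.bonusSum M alg T) (RaviUCB.runLaw M alg) ∧
    ((∀ x a, 0 < M.occ πstar x a → 0 < alg.π₀ x a) →
      ∫ ω, RaviUCB.regretSum M alg πstar T ω ∂(RaviUCB.runLaw M alg) ≤
        2 * ∫ ω, RaviUCB.bonusSum M alg T ω ∂(RaviUCB.runLaw M alg)
          + Real.sqrt (M.H ^ 4 * T / (2 * Real.log (Fintype.card A)))
            * (M.condRelEntropy πstar alg.π₀ + Real.log (Fintype.card A))
          + 2 * M.H ^ 2) ∧
    ((∀ x a, alg.π₀ x a = 1 / (Fintype.card A : ℝ)) →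
      ∫ ω, RaviUCB.regretSum M alg πstar T ω ∂(RaviUCB.runLaw M alg) ≤
        2 * ∫ ω, RaviUCB.bonusSum M alg T ω ∂(RaviUCB.runLaw M alg)
          + Real.sqrt (2 * M.H ^ 4 * Real.log (Fintype.card A) * T)
          + 2 * M.H ^ 2) := by
  have hH := M.H_pos
  have hT' : (0 : ℝ) < T := by exact_mod_cast hT
  have hc : (1 : ℝ) < Fintype.card A := by exact_mod_cast hA
  have hLpos := Real.log_pos hc
  have hηpos : 0 < alg.η := by rw [hη]; positivity
  have hsq : alg.η ^ 2 = 2 * Real.log (Fintype.card A) / (M.H ^ 2 * T) := by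
    rw [hη, Real.sq_sqrt (by positivity)]
  -- The learning rate is chosen so that `(H/η) log |A|` equals the stability term `ηH³T/2`.
  have hL : Real.log (Fintype.card A) = alg.η ^ 2 * M.H ^ 2 * T / 2 := by
    rw [hsq]; field_simp
  have hmain := fun hπ => RaviUCB.integral_regretSum_le_of_tuned M alg (πstar := πstar) hT hηpos
    hL hV₀ hvalid hstar hπ
  refine ⟨RaviUCB.integrable_regretSum M alg πstar T, RaviUCB.integrable_bonusSum M alg hT,
    fun hπ => ?_, fun hu => ?_⟩
  · have e : Real.sqrt (M.H ^ 4 * T / (2 * Real.log (Fintype.card A))) = M.H / alg.η := by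
      rw [Real.sqrt_eq_iff_mul_self_eq_of_pos (by positivity), ← sq, div_pow, hsq]
      field_simp
    rw [e]
    exact hmain hπ
  · have hK := M.condRelEntropy_uniform_le (πstar := πstar) hu
    have e : Real.sqrt (2 * M.H ^ 4 * Real.log (Fintype.card A) * T)
        = M.H / alg.η * (2 * Real.log (Fintype.card A)) := by
      rw [Real.sqrt_eq_iff_mul_self_eq_of_pos (by positivity), ← sq, mul_pow, div_pow, hsq]
      field_simp
    rw [e]
    refine (hmain fun x a _ => by rw [hu]; positivity).trans ?_
    have := mul_le_mul_of_nonneg_left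
      (show M.condRelEntropy πstar alg.π₀ + Real.log (Fintype.card A)
        ≤ 2 * Real.log (Fintype.card A) by linarith) (div_pos hH hηpos).le
    linarith
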